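/- Let $d\ge 1$ be an integer. There is a constant $C_d>0$, depending only on $d$, such that the following holds. Let $n\ge 1$ be an integer and let $J=[0,n^{1/d})^d$, regarded as a torus: addition is coordinatewise modulo $n^{1/d}$, and $B_\rho(x)$ denotes the closed ball of radius $\rho$ about $x$ in the toroidal Euclidean metric. Let $\psi$ be a measurable real-valued functional defined on all pairs $(x,\mathcal X)$ with $x\in J$ and $\mathcal X\subset J$ finite, and let $\|\psi\|=\sup_{x,\mathcal X}|\psi(x,\mathcal X)|$. Assume that $\psi$ is translation invariant, i.e. $\psi(x+y,\mathcal X+y)=\psi(x,\mathcal X)$ for all $x,y\in J$ and all finite $\mathcal X\subset J$, and that it has influence radius $\rho$, i.e. $\psi(x,\mathcal X)=\psi(x,\mathcal X\cap B_\rho(x))$ for all $x\in J$ and all finite $\mathcal X\subset J$, where $$\pi^{-1/2}\,\Gamma(1+d/2)^{1/d}\le\rho<\tfrac12 n^{1/d}.$$ Let $X_1,\dots,X_n$ be independent and uniformly distributed on $J$, and put $\mathcal X=\{X_1,\dots,X_n\}$, $U=\sum_{x\in\mathcal X}\psi(x,\mathcal X)$ and $\sigma^2=\operatorname{Var}U$.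 Assume that $\mathbb E\,\psi(X_1,\mathcal X)=0$ and $\sigma>0$, and let $W=U/\sigma$. Then $$d_{\mathrm W}\bigl(\mathcal L(W),\mathrm N(0,1)\bigr)\le\frac{C_d\,\|\psi\|^3\rho^{6d}\,n}{\sigma^3},$$ where $d_{\mathrm W}(P,Q)=\int_{-\infty}^{\infty}|P(t)-Q(t)|\,dt$ is the Wasserstein distance of two probability distributions on $\mathbb R$, given by their distribution functions. (If $\|\psi\|=\infty$, the right-hand side is $\infty$.) -/

import Mathlib

open MeasureTheory ProbabilityTheory
open scoped ENNReal

noncomputable section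

/-- The side length `n^{1/d}` of the torus. -/
def torusSide (d n : ℕ) : ℝ := (n : ℝ) ^ ((1 : ℝ) / d)

instance torusSide_pos (d n : ℕ) [NeZero n] : Fact (0 < torusSide d n) :=
  ⟨Real.rpow_pos_of_pos (Nat.cast_pos.mpr (Nat.pos_of_ne_zero (NeZero.ne n))) _⟩

/-- The torus `[0, n^{1/d})^d`: the `d`-fold product of the circle `ℝ / n^{1/d} ℤ`, with
coordinatewise addition and the product Lebesgue measure `volume`, of total mass `n`. -/
abbrev Torus (d n : ℕ) : Type := Fin d → AddCircle (torusSide d n)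

/-- The toroidal Euclidean metric; `‖x i - y i‖` is the distance of `x i` and `y i` on the circle,
that is, the least absolute value of a real representative of `x i - y i`. -/
def torusDist {d n : ℕ} (x y : Torus d n) : ℝ := √(∑ i, ‖x i - y i‖ ^ 2)

/-- A functional `ψ(x, 𝒳)` of a point `x` and a finite subset `𝒳` of the torus is measurable if
for every `k` it is a measurable function of `x` and of an enumeration `y_1, …, y_k` of `𝒳`. -/
def MeasurableFunctional {d n : ℕ} (ψ : Torus d n → Finset (Torus d n) → ℝ) : Prop :=
  open scoped Classical in
  ∀ k : ℕ, Measurable fun p : Torus d n × (Fin k → Torus d n) =>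
    ψ p.1 (Finset.univ.image p.2)

/-- `ψ(x + y, 𝒳 + y) = ψ(x, 𝒳)`, with addition on the torus. -/
def TranslationInvariant {d n : ℕ} (ψ : Torus d n → Finset (Torus d n) → ℝ) : Prop :=
  ∀ (x y : Torus d n) (𝒳 : Finset (Torus d n)),
    ψ (x + y) (𝒳.map (addRightEmbedding y)) = ψ x 𝒳

/-- `ψ(x, 𝒳) = ψ(x, 𝒳 ∩ B_ρ(x))`, where `B_ρ(x)` is the closed toroidal Euclidean ball. -/
def HasInfluenceRadius {d n : ℕ} (ψ : Torus d n → Finset (Torus d n) → ℝ) (ρ : ℝ) : Prop :=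
  open scoped Classical in
  ∀ (x : Torus d n) (𝒳 : Finset (Torus d n)), ψ x 𝒳 = ψ x (𝒳.filter fun y => torusDist x y ≤ ρ)

/-- The supremum norm of `ψ`, with value `∞` if `ψ` is unbounded. -/
def functionalNorm {d n : ℕ} (ψ : Torus d n → Finset (Torus d n) → ℝ) : ℝ≥0∞ :=
  ⨆ (x : Torus d n) (𝒳 : Finset (Torus d n)), ‖ψ x 𝒳‖ₑ

/-- The random set `𝒳 = {X_1, …, X_n}`. -/
def pointSet {d n : ℕ} {Ω : Type*} (X : Fin n → Ω → Torus d n) (ω : Ω) : Finset (Torus d n) :=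
  open scoped Classical in
  Finset.univ.image fun i => X i ω

/-- `U = ∑_{x ∈ 𝒳} ψ(x, 𝒳)`. -/
def neighbourhoodSum {d n : ℕ} {Ω : Type*} (ψ : Torus d n → Finset (Torus d n) → ℝ)
    (X : Fin n → Ω → Torus d n) (ω : Ω) : ℝ :=
  ∑ x ∈ pointSet X ω, ψ x (pointSet X ω)

/-- `σ = (Var U)^{1/2}`. -/
def neighbourhoodSigma {d n : ℕ} {Ω : Type*} [MeasurableSpace Ω] (P : Measure Ω)
    (ψ : Torus d n → Finset (Torus d n) → ℝ) (X : Fin n → Ω → Torus d n) : ℝ :=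
  √(variance (neighbourhoodSum ψ X) P)

/-- `W = U / σ`. -/
def neighbourhoodStatistic {d n : ℕ} {Ω : Type*} [MeasurableSpace Ω] (P : Measure Ω)
    (ψ : Torus d n → Finset (Torus d n) → ℝ) (X : Fin n → Ω → Torus d n) (ω : Ω) : ℝ :=
  neighbourhoodSum ψ X ω / neighbourhoodSigma P ψ X

/-- The Wasserstein distance of two probability measures on `ℝ`: the integral over `ℝ` of the
absolute difference of their distribution functions. -/
def wassersteinDist (P Q : Measure ℝ) : ℝ≥0∞ :=
  ∫⁻ t : ℝ, ENNReal.ofReal |cdf P t - cdf Q t|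

end

/-! The argument is Stein's method in Chatterjee's form for functions of independent variables. Let
`f` be the standardized statistic as a function of the point vector, `X'` an independent copy of the
points, and let `Δ_j f` be the change of `f` when point `j` alone is replaced by its copy. Replacing
the points one after another and using that swapping a point with its copy preserves the law gives
`Cov(f, g) = ½ ∑ E[D_j f · Δ_j g]` (`covariance_eq_sum_blockDiff_mul_singleDiff`), where `D_j` is
the change at `j` after all earlier points have been replaced. With `g = φ ∘ f`, `φ` a solution of
the Stein equation, and a Taylor expansion of `Δ_j (φ ∘ f)`, the discrepancy `E[φ'(f) - f φ(f)]` is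
at most a constant times `√(Var T) + ∑ E|Δ_j f|³`, where `T = ½ ∑ D_j f · Δ_j f` has mean `Var f =
1` (`integral_stein_le`). Wasserstein distance is reached by testing the difference of distribution
functions against continuous `g` with `|g| ≤ 1`, for which the Stein solutions are bounded uniformly
(`exists_stein_solution`).

`Var T` is bounded by Efron–Stein on the `2n` independent coordinates of `(X, X')`. This introduces
a second copy, hence families indexed by `(ι × Bool) × Bool`. By locality, replacing one coordinate
alters only the terms of `T` whose points come within `2ρ` of it, and each `Δ_j f` is at most `B =
‖ψ‖ / σ` times a neighbour count, up to constants. Such counts are dominated by binomial variables,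
so their moments are controlled by powers of `v`, a constant multiple of `ρ^d`.

This yields `Var T ≲ B⁴ n v⁹` and `∑ E|Δ_j f|³ ≲ B³ n v³`. Efron–Stein for `f` itself gives `1 = Var
f ≲ B² n v²`, and multiplying `Var T` by this turns its root into `B³ n v^(11/2)`. Since the lower
bound on `ρ` allows `v ≥ 1`, both terms are at most a constant times `B³ n v⁶`
(`IsLocalFunctional.wassersteinDist_le`). -/

/-! ### The Stein equation and bounds for its solutions. -/

open Filter Topology in
/-- Lower bound on `[0, ∞)` for the decaying solution of `u' = x u + k`. -/
lemma neg_le_of_hasDerivAt_mul_add {u k : ℝ → ℝ} {a b : ℝ} (ha : 0 ≤ a)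
    (hu : ∀ x, HasDerivAt u (x * u x + k x) x) (hk : ∀ x, 0 ≤ x → k x ≤ a + b * x)
    (hlim : Tendsto (fun x => Real.exp (-x ^ 2 / 2) * u x) atTop (𝓝 0)) {w : ℝ} (hw : 0 ≤ w) :
    -(b + 2 * a / (1 + w)) ≤ u w := by
  -- Comparison with the barrier `M x = b + 2a/(1+x)`: `exp(-x²/2) (u + M)` decreases to `0`, so it
  -- is nonnegative. The decay of `M` when `b = 0` is what later bounds `x φ'`, and with it `φ''`.
  set F : ℝ → ℝ := fun x => Real.exp (-x ^ 2 / 2) * (u x + (b + 2 * a / (1 + x))) with hF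
  have hexp : ∀ x : ℝ, HasDerivAt (fun x : ℝ => Real.exp (-x ^ 2 / 2))
      (Real.exp (-x ^ 2 / 2) * (-x)) x := fun x => by
    have h1 : HasDerivAt (fun x : ℝ => -x ^ 2 / 2) (-x) x := by
      exact (((hasDerivAt_pow 2 x).neg).div_const 2).congr_deriv (by norm_num; ring)
    exact h1.exp
  have hder : ∀ x : ℝ, 0 ≤ x → HasDerivAt F (Real.exp (-x ^ 2 / 2) * (-x) *
      (u x + (b + 2 * a / (1 + x))) + Real.exp (-x ^ 2 / 2) *
      ((x * u x + k x) + -(2 * a) / (1 + x) ^ 2)) x := fun x hx => by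
    have hne : (1 : ℝ) + x ≠ 0 := by positivity
    have h2 : HasDerivAt (fun x : ℝ => b + 2 * a / (1 + x)) (-(2 * a) / (1 + x) ^ 2) x := by
      exact (((hasDerivAt_const x (2 * a)).div ((hasDerivAt_id x).const_add 1) hne).const_add b
        ).congr_deriv (by simp)
    exact (hexp x).mul ((hu x).add h2)
  have hanti : AntitoneOn F (Set.Ici 0) := by
    apply antitoneOn_of_deriv_nonpos (convex_Ici 0)
    · exact fun x hx => (hder x hx).continuousAt.continuousWithinAt
    · intro x hx
      rw [interior_Ici] at hx
      exact (hder x (le_of_lt hx)).differentiableAt.differentiableWithinAt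
    · intro x hx
      rw [interior_Ici] at hx
      have hx0 : 0 ≤ x := le_of_lt hx
      rw [(hder x hx0).deriv]
      have hpos : 0 < 1 + x := by positivity
      -- This is `k ≤ x M - M'`, which makes the derivative of `F` nonpositive.
      have key : k x - x * (b + 2 * a / (1 + x)) + -(2 * a) / (1 + x) ^ 2 ≤ 0 := by
        have h1 := hk x hx0
        have h2 : a ≤ x * (2 * a / (1 + x)) + 2 * a / (1 + x) ^ 2 := by
          have : x * (2 * a / (1 + x)) + 2 * a / (1 + x) ^ 2 - a
              = a * (x ^ 2 + 1) / (1 + x) ^ 2 := by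
            field_simp; ring
          have h3 : 0 ≤ a * (x ^ 2 + 1) / (1 + x) ^ 2 := by positivity
          linarith
        have h4 : -(2 * a) / (1 + x) ^ 2 = -(2 * a / (1 + x) ^ 2) := by ring
        rw [h4]
        nlinarith
      have he : 0 ≤ Real.exp (-x ^ 2 / 2) := (Real.exp_pos _).le
      nlinarith [mul_nonpos_of_nonneg_of_nonpos he key]
  have hE : Tendsto (fun x : ℝ => Real.exp (-x ^ 2 / 2)) atTop (𝓝 0) := by
    apply Real.tendsto_exp_atBot.comp
    have h : Tendsto (fun x : ℝ => x ^ 2 / 2) atTop atTop :=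
      (tendsto_pow_atTop two_ne_zero).atTop_div_const two_pos
    refine (tendsto_neg_atTop_atBot.comp h).congr fun x => ?_
    simp only [Function.comp]; ring
  have hM : Tendsto (fun x : ℝ => b + 2 * a / (1 + x)) atTop (𝓝 (b + 0)) :=
    tendsto_const_nhds.add (tendsto_const_nhds.div_atTop (tendsto_atTop_add_const_left _ _ tendsto_id))
  have hFlim : Tendsto F atTop (𝓝 0) := by
    have := hlim.add (hE.mul hM)
    simp only [zero_mul, add_zero] at this
    refine this.congr fun x => ?_
    simp only [hF]; ring
  have hFw : 0 ≤ F w := by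
    refine le_of_tendsto hFlim ?_
    filter_upwards [eventually_ge_atTop w] with x hx
    exact hanti hw (le_trans hw hx) hx
  have := nonneg_of_mul_nonneg_right hFw (Real.exp_pos _)
  linarith

open Filter Topology in
/-- A solution of `u' = x u + k` that decays against the Gaussian density is controlled by `k`. -/
lemma abs_le_of_hasDerivAt_mul_add {u k : ℝ → ℝ} {a b : ℝ} (ha : 0 ≤ a)
    (hu : ∀ x, HasDerivAt u (x * u x + k x) x) (hk : ∀ x, |k x| ≤ a + b * |x|)
    (htop : Tendsto (fun x => Real.exp (-x ^ 2 / 2) * u x) atTop (𝓝 0))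
    (hbot : Tendsto (fun x => Real.exp (-x ^ 2 / 2) * u x) atBot (𝓝 0)) (w : ℝ) :
    |u w| ≤ b + 2 * a / (1 + |w|) := by
  have main : ∀ {u k : ℝ → ℝ}, (∀ x, HasDerivAt u (x * u x + k x) x) →
      (∀ x, |k x| ≤ a + b * |x|) → Tendsto (fun x => Real.exp (-x ^ 2 / 2) * u x) atTop (𝓝 0) →
      ∀ w, 0 ≤ w → |u w| ≤ b + 2 * a / (1 + w) := by
    intro u k hu hk htop w hw
    refine abs_le.mpr ⟨?_, ?_⟩
    · refine neg_le_of_hasDerivAt_mul_add ha hu (fun x hx => ?_) htop hw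
      have := (abs_le.mp (hk x)).2
      rwa [abs_of_nonneg hx] at this
    · have h := neg_le_of_hasDerivAt_mul_add (u := fun x => -u x) (k := fun x => -k x) (b := b) ha
        (fun x => (hu x).neg.congr_deriv (by ring))
        (fun x hx => ?_) ?_ hw
      · linarith
      · have := (abs_le.mp (hk x)).1
        rw [abs_of_nonneg hx] at this
        linarith
      · simpa using htop.neg
  rcases le_total 0 w with hw | hw
  · rw [abs_of_nonneg hw]
    exact main hu hk htop w hw
  -- The equation is preserved by reflection: `-u(-x)` solves it with `k(-x)`.
  · have h := main (u := fun x => -u (-x)) (k := fun x => k (-x)) (fun x => ?_)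
      (fun x => by simpa using hk (-x)) ?_ (-w) (by linarith)
    · rw [abs_of_nonpos hw]
      simpa using h
    · have h1 := (hu (-x)).comp x (hasDerivAt_neg x)
      exact h1.neg.congr_deriv (by ring)
    · have := (hbot.comp tendsto_neg_atTop_atBot).neg
      simpa [Function.comp_def] using this

open Filter Topology in
/-- The Stein equation `φ' = x φ + k` with a bounded continuous right side of Gaussian mean zero
has a solution that decays against the Gaussian density. -/
lemma exists_hasDerivAt_mul_add {k : ℝ → ℝ} {c : ℝ} (hk : Continuous k) (hc : ∀ x, |k x| ≤ c)
    (h0 : ∫ x, k x ∂(gaussianReal 0 1) = 0) :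
    ∃ φ : ℝ → ℝ, (∀ x, HasDerivAt φ (x * φ x + k x) x) ∧
      Tendsto (fun x => Real.exp (-x ^ 2 / 2) * φ x) atTop (𝓝 0) ∧
      Tendsto (fun x => Real.exp (-x ^ 2 / 2) * φ x) atBot (𝓝 0) := by
  set q : ℝ → ℝ := fun x => k x * Real.exp (-x ^ 2 / 2) with hq
  have hqc : Continuous q := by fun_prop
  have hqi : Integrable q := by
    have h1 : Integrable (fun x : ℝ => Real.exp (-(1 / 2) * x ^ 2)) :=
      integrable_exp_neg_mul_sq (by norm_num)
    have h2 := h1.bdd_mul (f := k) (c := c) hk.aestronglyMeasurable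
      (Eventually.of_forall fun x => by simpa using hc x)
    refine h2.congr (Eventually.of_forall fun x => ?_)
    simp only [hq]
    congr 2
    ring
  have hq0 : ∫ x, q x = 0 := by
    rw [integral_gaussianReal_eq_integral_smul one_ne_zero] at h0
    have : ∀ x : ℝ, gaussianPDFReal 0 1 x • k x = (√(2 * Real.pi))⁻¹ * q x := fun x => by
      simp [gaussianPDFReal_def, hq]
      ring
    simp_rw [this] at h0
    rw [integral_const_mul] at h0
    rcases mul_eq_zero.mp h0 with h | h
    · exact absurd h (by positivity)
    · exact h
  set I : ℝ := ∫ x in Set.Iic 0, q x with hI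
  -- `G w` is the integral of `q` over `(-∞, w]`. It vanishes at `+∞` as well because `k` has
  -- Gaussian mean zero; the solution is `exp(w²/2) G w`.
  set G : ℝ → ℝ := fun w => I + ∫ x in (0 : ℝ)..w, q x with hG
  have hGd : ∀ w, HasDerivAt G (q w) w := fun w =>
    (intervalIntegral.integral_hasDerivAt_right (hqc.intervalIntegrable _ _)
      (hqc.stronglyMeasurableAtFilter _ _) hqc.continuousAt).const_add I
  have hGtop : Tendsto G atTop (𝓝 0) := by
    have h1 := (intervalIntegral_tendsto_integral_Ioi (μ := volume) (f := q) 0 hqi.integrableOn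
      (tendsto_id (α := ℝ) (x := atTop))).const_add I
    rwa [hI, intervalIntegral.integral_Iic_add_Ioi hqi.integrableOn hqi.integrableOn, hq0] at h1
  have hGbot : Tendsto G atBot (𝓝 0) := by
    have h1 := (intervalIntegral_tendsto_integral_Iic (μ := volume) (f := q) 0 hqi.integrableOn
      (tendsto_id (α := ℝ) (x := atBot))).const_sub I
    rw [← hI, sub_self] at h1
    refine h1.congr fun w => ?_
    simp only [hG, id]
    rw [intervalIntegral.integral_symm]
    ring
  have hee : ∀ x : ℝ, Real.exp (-x ^ 2 / 2) * Real.exp (x ^ 2 / 2) = 1 := fun x => by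
    rw [← Real.exp_add]
    simp [neg_div]
  refine ⟨fun w => Real.exp (w ^ 2 / 2) * G w, fun x => ?_, ?_, ?_⟩
  · have h1 : HasDerivAt (fun x : ℝ => x ^ 2 / 2) x x := by
      exact ((hasDerivAt_pow 2 x).div_const 2).congr_deriv (by norm_num)
    refine (h1.exp.mul (hGd x)).congr_deriv ?_
    have := hee x
    simp only [hq]
    linear_combination k x * this
  · refine hGtop.congr fun x => ?_
    rw [← mul_assoc, hee, one_mul]
  · refine hGbot.congr fun x => ?_
    rw [← mul_assoc, hee, one_mul]

lemma integrable_abs_gaussianReal : Integrable (fun x : ℝ => |x|) (gaussianReal 0 1) := by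
  have h : MemLp id 1 (gaussianReal 0 1) := by
    simpa using memLp_id_gaussianReal (μ := 0) (v := 1) 1
  exact (memLp_one_iff_integrable.mp h).abs

lemma integrable_sq_gaussianReal : Integrable (fun x : ℝ => x ^ 2) (gaussianReal 0 1) := by
  have h : MemLp id 2 (gaussianReal 0 1) := by
    simpa using memLp_id_gaussianReal (μ := 0) (v := 1) 2
  exact h.integrable_sq

lemma integral_abs_gaussianReal_le_one : ∫ x, |x| ∂(gaussianReal 0 1) ≤ 1 := by
  have hv := variance_eq_integral (μ := gaussianReal 0 1) (X := id) aemeasurable_id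
  rw [variance_id_gaussianReal] at hv
  simp only [id, integral_id_gaussianReal, sub_zero, NNReal.coe_one] at hv
  have h2 : ∫ x : ℝ, |x| ∂(gaussianReal 0 1) ≤ ∫ x : ℝ, (1 / 2 + x ^ 2 / 2) ∂(gaussianReal 0 1) := by
    refine integral_mono integrable_abs_gaussianReal
      ((integrable_const _).add (integrable_sq_gaussianReal.div_const 2)) fun x => ?_
    simp only
    nlinarith [sq_nonneg (|x| - 1), sq_abs x]
  rw [integral_add (integrable_const _) (integrable_sq_gaussianReal.div_const 2),
    integral_div _ (fun x : ℝ => x ^ 2), ← hv] at h2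
  simp only [integral_const, probReal_univ, one_smul] at h2
  linarith

open Filter Topology in
/-- Solution of the Stein equation for the test function `x ↦ ∫ t in Ioi x, g t`. -/
lemma exists_stein_solution {g : ℝ → ℝ} (hg : Continuous g) (hgi : Integrable g)
    (hg1 : ∀ x, |g x| ≤ 1) :
    ∃ φ φ' φ'' : ℝ → ℝ, (∀ x, HasDerivAt φ (φ' x) x) ∧ (∀ x, HasDerivAt φ' (φ'' x) x) ∧
      (∀ x, |φ x| ≤ 3) ∧ (∀ x, |φ' x| ≤ 8) ∧ (∀ x, |φ'' x| ≤ 12) ∧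
      ∀ x, φ' x - x * φ x
        = (∫ t in Set.Ioi x, g t) - ∫ y, (∫ t in Set.Ioi y, g t) ∂(gaussianReal 0 1) := by
  set H : ℝ → ℝ := fun x => ∫ t in Set.Ioi x, g t with hH
  set m := ∫ y, H y ∂(gaussianReal 0 1) with hm
  have hHd : ∀ x, HasDerivAt H (-g x) x := by
    have heq : H = fun x => (∫ t in Set.Ioi (0 : ℝ), g t) - ∫ t in (0 : ℝ)..x, g t := by
      funext x
      rw [← intervalIntegral.integral_Ioi_sub_Ioi' hgi.integrableOn hgi.integrableOn]
      simp [hH]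
    intro x
    rw [heq]
    exact (intervalIntegral.integral_hasDerivAt_right (hg.intervalIntegrable _ _)
      (hg.stronglyMeasurableAtFilter _ _) hg.continuousAt).const_sub _
  have hHc : Continuous H := continuous_iff_continuousAt.mpr fun x => (hHd x).continuousAt
  have hHb : ∀ x, |H x| ≤ ∫ t, |g t| := fun x => by
    calc |H x| ≤ ∫ t in Set.Ioi x, |g t| := by
          simpa using norm_integral_le_integral_norm (μ := volume.restrict (Set.Ioi x)) g
      _ ≤ ∫ t, |g t| := setIntegral_le_integral hgi.abs (Eventually.of_forall fun _ => abs_nonneg _)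
  have hHi : Integrable H (gaussianReal 0 1) :=
    Integrable.of_bound hHc.aestronglyMeasurable _ (Eventually.of_forall fun x => by
      simpa using hHb x)
  have hHlip : ∀ x y, |H x - H y| ≤ |x - y| := fun x y => by
    have := Convex.norm_image_sub_le_of_norm_hasDerivWithin_le (f := H) (f' := fun x => -g x)
      (s := Set.univ) (C := 1) (x := y) (y := x) (fun x _ => (hHd x).hasDerivWithinAt)
      (fun x _ => by simpa using hg1 x) convex_univ trivial trivial
    simpa using this
  set k : ℝ → ℝ := fun x => H x - m with hk
  -- `H` is 1-Lipschitz because `H' = -g`, and `E|N| ≤ 1`. This growth bound does not depend on `∫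
  -- |g|`, so the final constants are uniform in `g`.
  have hklin : ∀ x, |k x| ≤ 1 + 1 * |x| := fun x => by
    have h1 : k x = ∫ y, (H x - H y) ∂(gaussianReal 0 1) := by
      rw [integral_sub (integrable_const _) hHi]
      simp [hk, hm]
    rw [h1]
    calc |∫ y, (H x - H y) ∂(gaussianReal 0 1)|
        ≤ ∫ y, |H x - H y| ∂(gaussianReal 0 1) := abs_integral_le_integral_abs
      _ ≤ ∫ y, (|x| + |y|) ∂(gaussianReal 0 1) := by
          refine integral_mono ((integrable_const _).sub hHi).abs
            ((integrable_const _).add integrable_abs_gaussianReal) fun y => ?_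
          exact (hHlip x y).trans (abs_sub _ _)
      _ = |x| + ∫ y, |y| ∂(gaussianReal 0 1) := by
          rw [integral_add (integrable_const _) integrable_abs_gaussianReal]
          simp
      _ ≤ 1 + 1 * |x| := by linarith [integral_abs_gaussianReal_le_one]
  have hkc : Continuous k := hHc.sub continuous_const
  have hkb : ∀ x, |k x| ≤ (∫ t, |g t|) + |m| := fun x =>
    (abs_sub _ _).trans (by linarith [hHb x])
  have hk0 : ∫ x, k x ∂(gaussianReal 0 1) = 0 := by
    simp only [hk]
    rw [integral_sub hHi (integrable_const _)]
    simp [hm]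
  obtain ⟨φ, hφ, htop, hbot⟩ := exists_hasDerivAt_mul_add hkc hkb hk0
  have hφb : ∀ x, |φ x| ≤ 3 := fun x => by
    have h1 := abs_le_of_hasDerivAt_mul_add zero_le_one hφ hklin htop hbot x
    have h2 : 2 * 1 / (1 + |x|) ≤ 2 := by
      rw [div_le_iff₀ (by positivity)]
      linarith [abs_nonneg x]
    linarith
  set φ' : ℝ → ℝ := fun x => x * φ x + k x with hφ'
  -- The derivative solves the same equation with right side `φ - g`, bounded by `3 + 1`. The
  -- comparison lemma then gives `|φ' x| ≤ 8 / (1 + |x|)`, hence `|x φ' x| ≤ 8` and `|φ''| ≤ 8 + 4`.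
  have hφ'd : ∀ x, HasDerivAt φ' (x * φ' x + (φ x - g x)) x := fun x => by
    refine (((hasDerivAt_id x).mul (hφ x)).add ((hHd x).sub_const m)).congr_deriv ?_
    simp only [hφ', id]
    ring
  have hdecay : ∀ l : Filter ℝ,
      Tendsto (fun x : ℝ => Real.exp (-x ^ 2 / 2) * x) l (𝓝 0) →
      Tendsto (fun x : ℝ => Real.exp (-x ^ 2 / 2)) l (𝓝 0) →
      Tendsto (fun x : ℝ => Real.exp (-x ^ 2 / 2) * φ' x) l (𝓝 0) := by
    intro l h1 h2
    have h3 := h1.zero_mul_isBoundedUnder_le (g := φ)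
      (isBoundedUnder_of ⟨3, fun x => by simpa using hφb x⟩)
    have h4 := h2.zero_mul_isBoundedUnder_le (g := k)
      (isBoundedUnder_of ⟨_, fun x => by simpa using hkb x⟩)
    have := h3.add h4
    rw [add_zero] at this
    refine this.congr fun x => ?_
    simp only [hφ']
    ring
  have hxt : Tendsto (fun x : ℝ => Real.exp (-x ^ 2 / 2) * x) atTop (𝓝 0) := by
    have h := (Real.tendsto_pow_mul_exp_neg_atTop_nhds_zero 1)
    refine squeeze_zero' (eventually_ge_atTop 0 |>.mono fun x hx => by positivity)
      ((eventually_ge_atTop 2).mono fun x hx => ?_) h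
    rw [pow_one, mul_comm]
    exact mul_le_mul_of_nonneg_left (Real.exp_le_exp.mpr (by nlinarith)) (by linarith)
  have het : Tendsto (fun x : ℝ => Real.exp (-x ^ 2 / 2)) atTop (𝓝 0) := by
    refine squeeze_zero' (Eventually.of_forall fun x => (Real.exp_pos _).le)
      ((eventually_ge_atTop 1).mono fun x hx => ?_) hxt
    exact le_mul_of_one_le_right (Real.exp_pos _).le hx
  have hxb : Tendsto (fun x : ℝ => Real.exp (-x ^ 2 / 2) * x) atBot (𝓝 0) := by
    have := (hxt.comp tendsto_neg_atBot_atTop).neg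
    simpa [Function.comp_def] using this
  have heb : Tendsto (fun x : ℝ => Real.exp (-x ^ 2 / 2)) atBot (𝓝 0) := by
    have := het.comp tendsto_neg_atBot_atTop
    simpa [Function.comp_def] using this
  have hk2 : ∀ x, |φ x - g x| ≤ 4 + 0 * |x| := fun x => by
    have := (abs_sub (φ x) (g x)).trans (add_le_add (hφb x) (hg1 x))
    linarith
  have hφ'w := abs_le_of_hasDerivAt_mul_add (by norm_num : (0 : ℝ) ≤ 4) hφ'd hk2
    (hdecay _ hxt het) (hdecay _ hxb heb)
  refine ⟨φ, φ', fun x => x * φ' x + (φ x - g x), hφ, hφ'd, hφb, fun x => ?_, fun x => ?_,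
    fun x => ?_⟩
  · refine (hφ'w x).trans ?_
    rw [zero_add, div_le_iff₀ (by positivity)]
    linarith [abs_nonneg x]
  · have h1 : |x| * |φ' x| ≤ 8 := by
      refine (mul_le_mul_of_nonneg_left (hφ'w x) (abs_nonneg x)).trans ?_
      have hp : 0 < 1 + |x| := by positivity
      rw [zero_add, ← mul_div_assoc, div_le_iff₀ hp]
      linarith [abs_nonneg x]
    have h2 := abs_add_le (x * φ' x) (φ x - g x)
    rw [abs_mul] at h2
    have := hk2 x
    linarith
  · simp only [hφ', hk]
    ring

/-! ### From Stein bounds to the integral of the difference of distribution functions. -/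

/-- Integrating the distribution function against `g` is integrating the tail integral of `g`. -/
lemma integral_mul_cdf (Q : Measure ℝ) [IsProbabilityMeasure Q] {g : ℝ → ℝ} (hgi : Integrable g) :
    ∫ t, g t * cdf Q t = ∫ x, (∫ t in Set.Ioi x, g t) ∂Q := by
  set S : Set (ℝ × ℝ) := {p | p.2 ≤ p.1} with hS
  have hSm : MeasurableSet S := measurableSet_le measurable_snd measurable_fst
  have hint : Integrable (Function.uncurry fun t x => S.indicator (fun p => g p.1) (t, x))
      ((volume : Measure ℝ).prod Q) := by
    have h : Integrable (fun p : ℝ × ℝ => g p.1) ((volume : Measure ℝ).prod Q) := hgi.comp_fst Q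
    exact h.indicator hSm
  have h1 : ∀ t, ∫ x, S.indicator (fun p => g p.1) (t, x) ∂Q = g t * cdf Q t := fun t => by
    have : ∀ x, S.indicator (fun p => g p.1) (t, x) = (Set.Iic t).indicator (fun _ => g t) x :=
      fun x => by simp [Set.indicator, hS]
    simp_rw [this]
    rw [integral_indicator measurableSet_Iic, setIntegral_const, cdf_eq_real, smul_eq_mul, mul_comm]
  have h2 : ∀ x, ∫ t, S.indicator (fun p => g p.1) (t, x) = ∫ t in Set.Ioi x, g t := fun x => by
    have : ∀ t, S.indicator (fun p => g p.1) (t, x) = (Set.Ici x).indicator g t :=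
      fun x => by simp [Set.indicator, hS]
    simp_rw [this]
    rw [integral_indicator measurableSet_Ici, integral_Ici_eq_integral_Ioi]
  calc ∫ t, g t * cdf Q t = ∫ t, ∫ x, S.indicator (fun p => g p.1) (t, x) ∂Q := by simp_rw [h1]
    _ = ∫ x, (∫ t, S.indicator (fun p => g p.1) (t, x)) ∂Q := integral_integral_swap hint
    _ = _ := by simp_rw [h2]

/-- Chebyshev tails: two distribution functions with second moments are within
`O(1 / (1 + t ^ 2))` of each other. -/
lemma abs_cdf_sub_cdf_le (P Q : Measure ℝ) [IsProbabilityMeasure P] [IsProbabilityMeasure Q]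
    (hP : Integrable (fun x => x ^ 2) P) (hQ : Integrable (fun x => x ^ 2) Q) (t : ℝ) :
    |cdf P t - cdf Q t| ≤ (∫ x, (1 + x ^ 2) ∂P + ∫ x, (1 + x ^ 2) ∂Q) * (1 + t ^ 2)⁻¹ := by
  have hpos : 0 < 1 + t ^ 2 := by positivity
  have hmark : ∀ (μ : Measure ℝ) [IsProbabilityMeasure μ], Integrable (fun x => x ^ 2) μ →
      ∀ s : Set ℝ, MeasurableSet s → (∀ x ∈ s, t ^ 2 ≤ x ^ 2) →
      μ.real s * (1 + t ^ 2) ≤ ∫ x, (1 + x ^ 2) ∂μ := by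
    intro μ _ hμ s hs hst
    have hi : Integrable (fun x : ℝ => 1 + x ^ 2) μ := (integrable_const _).add hμ
    calc μ.real s * (1 + t ^ 2) = ∫ x, s.indicator (fun _ => 1 + t ^ 2) x ∂μ := by
          rw [integral_indicator hs, setIntegral_const, smul_eq_mul]
      _ ≤ ∫ x, (1 + x ^ 2) ∂μ := by
          refine integral_mono ((integrable_const _).indicator hs) hi fun x => ?_
          by_cases hx : x ∈ s
          · simpa [hx] using hst x hx
          · simp only [Set.indicator_of_notMem hx]
            positivity
  rw [← div_eq_mul_inv, le_div_iff₀ hpos]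
  have hcompl : ∀ (μ : Measure ℝ) [IsProbabilityMeasure μ],
      cdf μ t = 1 - μ.real (Set.Ioi t) := fun μ _ => by
    rw [cdf_eq_real, ← Set.compl_Iic, probReal_compl_eq_one_sub measurableSet_Iic]
    ring
  have hab : ∀ a b : ℝ, 0 ≤ a → 0 ≤ b → |a - b| ≤ a + b := fun a b ha hb =>
    abs_sub_le_iff.mpr ⟨by linarith, by linarith⟩
  have key : |cdf P t - cdf Q t| * (1 + t ^ 2)
      ≤ ∫ x, (1 + x ^ 2) ∂P + ∫ x, (1 + x ^ 2) ∂Q := by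
    -- Markov's inequality for `1 + x²` controls the tail on the far side of `t`: the upper one for
    -- `t ≥ 0`, the lower one for `t ≤ 0`.
    rcases le_total 0 t with ht | ht
    · have h1 := hmark P hP (Set.Ioi t) measurableSet_Ioi fun x hx => by
        have : t < x := hx
        nlinarith
      have h2 := hmark Q hQ (Set.Ioi t) measurableSet_Ioi fun x hx => by
        have : t < x := hx
        nlinarith
      have h3 := hab (Q.real (Set.Ioi t)) (P.real (Set.Ioi t)) measureReal_nonneg measureReal_nonneg
      rw [hcompl P, hcompl Q]
      have : 1 - P.real (Set.Ioi t) - (1 - Q.real (Set.Ioi t))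
        = Q.real (Set.Ioi t) - P.real (Set.Ioi t) := by ring
      rw [this]
      nlinarith
    · have h1 := hmark P hP (Set.Iic t) measurableSet_Iic fun x hx => by
        have : x ≤ t := hx
        nlinarith
      have h2 := hmark Q hQ (Set.Iic t) measurableSet_Iic fun x hx => by
        have : x ≤ t := hx
        nlinarith
      have h3 := hab (P.real (Set.Iic t)) (Q.real (Set.Iic t)) measureReal_nonneg measureReal_nonneg
      rw [cdf_eq_real P, cdf_eq_real Q]
      nlinarith
  exact key

lemma measurable_cdf (P : Measure ℝ) : Measurable (cdf P) := (monotone_cdf P).measurable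

lemma integrable_cdf_sub_cdf (P Q : Measure ℝ) [IsProbabilityMeasure P] [IsProbabilityMeasure Q]
    (hP : Integrable (fun x => x ^ 2) P) (hQ : Integrable (fun x => x ^ 2) Q) :
    Integrable (fun t => cdf P t - cdf Q t) :=
  (integrable_inv_one_add_sq.const_mul (∫ x, (1 + x ^ 2) ∂P + ∫ x, (1 + x ^ 2) ∂Q)).mono'
    ((measurable_cdf P).sub (measurable_cdf Q)).aestronglyMeasurable
    (Filter.Eventually.of_forall fun t => abs_cdf_sub_cdf_le P Q hP hQ t)

/-- The `L¹` norm is tested by continuous compactly supported functions bounded by one. -/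
lemma integral_abs_le_of_forall_continuous {D : ℝ → ℝ} (hD : Integrable D) {β : ℝ}
    (hβ : ∀ g : ℝ → ℝ, Continuous g → HasCompactSupport g → (∀ x, |g x| ≤ 1) →
      ∫ t, g t * D t ≤ β) :
    ∫ t, |D t| ≤ β := by
  refine le_of_forall_pos_le_add fun ε hε => ?_
  obtain ⟨E, hEs, hEd, hEc, hEi⟩ := hD.exists_hasCompactSupport_integral_sub_le
    (show 0 < ε / 4 by positivity)
  set K := tsupport E with hK
  have hKc : IsCompact K := hEs
  set v := volume.real K with hv
  have hv0 : 0 ≤ v := measureReal_nonneg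
  set δ := ε / 4 / (1 + v) with hδ
  have hδ0 : 0 < δ := by positivity
  -- A continuous sign of `E`: the clipped quotient loses at most `δ` at each point of the support,
  -- `δ v ≤ ε/4` in total, while replacing `D` by `E` costs at most `2 · ε/4`.
  set g : ℝ → ℝ := fun t => max (-1) (min 1 (E t / δ)) with hg
  have hgc : Continuous g := by fun_prop
  have hgs : HasCompactSupport g := by
    refine hEs.mono fun t ht => ?_
    rw [Function.mem_support] at ht ⊢
    contrapose! ht
    simp [hg, ht]
  have hg1 : ∀ t, |g t| ≤ 1 := fun t => abs_le.mpr
    ⟨le_max_left _ _, max_le (by norm_num) (min_le_left _ _)⟩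
  have hgE : ∀ t, |E t| - δ ≤ g t * E t := fun t => by
    rcases le_or_gt 1 (E t / δ) with h | h
    · have h0 : g t = 1 := by
        simp only [hg, min_eq_left h]
        norm_num
      have h2 : 0 ≤ E t := by
        rw [le_div_iff₀ hδ0] at h
        linarith
      rw [h0, abs_of_nonneg h2]
      linarith
    · rcases le_or_gt (E t / δ) (-1) with h' | h'
      · have h0 : g t = -1 := by
          simp only [hg, min_eq_right h.le]
          exact max_eq_left h'
        have h2 : E t ≤ 0 := by
          rw [div_le_iff₀ hδ0] at h'
          linarith
        rw [h0, abs_of_nonpos h2]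
        linarith
      · have h1 : |E t| ≤ δ := by
          rw [lt_div_iff₀ hδ0] at h'
          rw [div_lt_iff₀ hδ0] at h
          exact abs_le.mpr ⟨by linarith, by linarith⟩
        have h0 : g t = E t / δ := by
          simp only [hg, min_eq_right h.le]
          exact max_eq_right h'.le
        have h3 : 0 ≤ E t / δ * E t := by
          rw [div_mul_eq_mul_div]
          exact div_nonneg (mul_self_nonneg _) hδ0.le
        rw [h0]
        linarith
  have hpt : ∀ t, |D t| ≤ g t * D t + (2 * ‖D t - E t‖ + K.indicator (fun _ => δ) t) := fun t => by
    rw [Real.norm_eq_abs]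
    have h1 : |D t| ≤ |D t - E t| + |E t| := by simpa using abs_add_le (D t - E t) (E t)
    have h2 : |E t| ≤ g t * E t + K.indicator (fun _ => δ) t := by
      by_cases ht : t ∈ K
      · rw [Set.indicator_of_mem ht]
        linarith [hgE t]
      · rw [Set.indicator_of_notMem ht]
        simp [image_eq_zero_of_notMem_tsupport ht]
    have h3 : g t * E t - g t * D t ≤ |D t - E t| := by
      have h4 : |g t * (E t - D t)| ≤ 1 * |E t - D t| := by
        rw [abs_mul]
        exact mul_le_mul_of_nonneg_right (hg1 t) (abs_nonneg _)
      rw [one_mul, abs_sub_comm (E t)] at h4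
      have := le_abs_self (g t * (E t - D t))
      linarith
    linarith
  have hgD : Integrable (fun t => g t * D t) :=
    hD.bdd_mul (c := 1) hgc.aestronglyMeasurable (Filter.Eventually.of_forall fun t => by
      simpa using hg1 t)
  have hDE : Integrable (fun t => 2 * ‖D t - E t‖) := (hD.sub hEi).norm.const_mul 2
  have hKi : Integrable (K.indicator (fun _ => δ)) :=
    (integrable_indicator_iff hKc.measurableSet).mpr
      (integrableOn_const hKc.measure_lt_top.ne)
  have h1 : ∫ t, |D t| ≤ ∫ t, (g t * D t + (2 * ‖D t - E t‖ + K.indicator (fun _ => δ) t)) :=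
    integral_mono hD.abs (hgD.add (hDE.add hKi)) hpt
  rw [integral_add hgD (by exact hDE.add hKi), integral_add hDE hKi, integral_const_mul,
    integral_indicator hKc.measurableSet, setIntegral_const, smul_eq_mul] at h1
  have h2 : v * δ ≤ ε / 4 := by
    rw [hδ, ← mul_div_assoc, div_le_iff₀ (by positivity)]
    nlinarith
  have h3 := hβ g hgc hgs hg1
  linarith

/-- Stein's method for the Wasserstein distance. -/
theorem wassersteinDist_gaussianReal_le (P : Measure ℝ) [IsProbabilityMeasure P]
    (hP : Integrable (fun x => x ^ 2) P) {β : ℝ}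
    (hβ : ∀ φ φ' φ'' : ℝ → ℝ, (∀ x, HasDerivAt φ (φ' x) x) → (∀ x, HasDerivAt φ' (φ'' x) x) →
      (∀ x, |φ x| ≤ 3) → (∀ x, |φ' x| ≤ 8) → (∀ x, |φ'' x| ≤ 12) →
      ∫ x, (φ' x - x * φ x) ∂P ≤ β) :
    wassersteinDist P (gaussianReal 0 1) ≤ ENNReal.ofReal β := by
  have hD := integrable_cdf_sub_cdf P (gaussianReal 0 1) hP integrable_sq_gaussianReal
  have hle : ∫ t, |cdf P t - cdf (gaussianReal 0 1) t| ≤ β := by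
    refine integral_abs_le_of_forall_continuous hD fun g hgc hgs hg1 => ?_
    have hgi : Integrable g := hgc.integrable_of_hasCompactSupport hgs
    obtain ⟨φ, φ', φ'', h1, h2, h3, h4, h5, h6⟩ := exists_stein_solution hgc hgi hg1
    have hcdf : ∀ Q : Measure ℝ, IsProbabilityMeasure Q → Integrable fun t => g t * cdf Q t :=
      fun Q _ => hgi.mul_bdd (c := 1) (measurable_cdf Q).aestronglyMeasurable
        (Filter.Eventually.of_forall fun t => by
          rw [Real.norm_eq_abs, abs_of_nonneg (cdf_nonneg Q t)]
          exact cdf_le_one Q t)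
    have hHi : Integrable (fun x => ∫ t in Set.Ioi x, g t) P := by
      refine Integrable.of_bound (C := ∫ t, |g t|) ?_ (Filter.Eventually.of_forall fun x => ?_)
      · have heq : (fun x => ∫ t in Set.Ioi x, g t) = fun x => (φ' x - x * φ x)
            + ∫ y, (∫ t in Set.Ioi y, g t) ∂(gaussianReal 0 1) := by
          funext x
          rw [h6]
          ring
        have hc1 : Continuous φ := continuous_iff_continuousAt.mpr fun x => (h1 x).continuousAt
        have hc2 : Continuous φ' := continuous_iff_continuousAt.mpr fun x => (h2 x).continuousAt
        rw [heq]
        exact Continuous.aestronglyMeasurable (by fun_prop)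
      · calc ‖∫ t in Set.Ioi x, g t‖ ≤ ∫ t in Set.Ioi x, |g t| :=
              norm_integral_le_integral_norm (μ := volume.restrict (Set.Ioi x)) g
          _ ≤ ∫ t, |g t| :=
              setIntegral_le_integral hgi.abs (Filter.Eventually.of_forall fun _ => abs_nonneg _)
    -- By Fubini, integrating `g` against a distribution function is an expectation of its tail
    -- integral, which is the right side of the Stein equation for `φ`.
    have hkey : ∫ x, (φ' x - x * φ x) ∂P
        = ∫ t, g t * (cdf P t - cdf (gaussianReal 0 1) t) := by
      simp_rw [h6, mul_sub]
      rw [integral_sub (hcdf P inferInstance) (hcdf _ inferInstance), integral_mul_cdf P hgi,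
        integral_mul_cdf _ hgi, integral_sub hHi (integrable_const _)]
      simp
    rw [← hkey]
    exact hβ φ φ' φ'' h1 h2 h3 h4 h5
  unfold wassersteinDist
  rw [← ofReal_integral_eq_lintegral_ofReal hD.abs
    (Filter.Eventually.of_forall fun _ => abs_nonneg _)]
  exact ENNReal.ofReal_le_ofReal hle

/-! ### Exchanging coordinates with independent copies; the Efron–Stein inequality. -/

/-- Selecting distinct coordinates of an i.i.d. family gives an i.i.d. family. -/
lemma measurePreserving_comp_injective {E ι κ : Type*} [MeasurableSpace E] (μ : Measure E)
    [IsProbabilityMeasure μ] [Fintype ι] [Fintype κ] {σ : ι → κ} (hσ : Function.Injective σ) :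
    MeasurePreserving (fun (Y : κ → E) (i : ι) => Y (σ i)) (Measure.pi fun _ => μ)
      (Measure.pi fun _ => μ) := by
  refine ⟨by fun_prop, ?_⟩
  have h1 : iIndepFun (fun (k : κ) (Y : κ → E) => Y k) (Measure.pi fun _ => μ) :=
    iIndepFun_pi (X := fun _ => id) fun _ => aemeasurable_id
  have h2 := h1.precomp hσ
  rw [iIndepFun_iff_map_fun_eq_pi_map (fun i => (measurable_pi_apply _).aemeasurable)] at h2
  rw [h2]
  congr 1
  funext i
  exact (measurePreserving_eval (fun _ : κ => μ) (σ i)).map_eq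

lemma integral_comp_injective {E ι κ : Type*} [MeasurableSpace E] (μ : Measure E)
    [IsProbabilityMeasure μ] [Fintype ι] [Fintype κ] {σ : ι → κ} (hσ : Function.Injective σ)
    {F : (ι → E) → ℝ} (hF : Measurable F) :
    ∫ Y : κ → E, F (fun i => Y (σ i)) ∂(Measure.pi fun _ => μ)
      = ∫ y, F y ∂(Measure.pi fun _ => μ) := by
  have h := measurePreserving_comp_injective μ hσ
  rw [← h.map_eq, integral_map h.measurable.aemeasurable hF.aestronglyMeasurable]

lemma integrable_of_measurable_of_abs_le {Ω : Type*} [MeasurableSpace Ω] {P : Measure Ω}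
    [IsFiniteMeasure P] {f : Ω → ℝ} (hf : Measurable f) {C : ℝ} (hC : ∀ ω, |f ω| ≤ C) :
    Integrable f P :=
  Integrable.of_bound hf.aestronglyMeasurable C (Filter.Eventually.of_forall hC)

lemma abs_sub_le_two_mul {x y C : ℝ} (hx : |x| ≤ C) (hy : |y| ≤ C) : |x - y| ≤ 2 * C :=
  (abs_sub x y).trans (by linarith)

lemma abs_mul_le_mul_of_le {x y C D : ℝ} (hx : |x| ≤ C) (hy : |y| ≤ D) : |x * y| ≤ C * D := by
  rw [abs_mul]
  exact mul_le_mul hx hy (abs_nonneg y) ((abs_nonneg x).trans hx)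

section Exchange

variable {E : Type*} {n : ℕ}

/-- The change of `f` when coordinate `j` is replaced by its copy, all earlier coordinates having
been replaced already. -/
def blockDiff (f : (Fin n → E) → ℝ) (j : Fin n) (Y : Fin n × Bool → E) : ℝ :=
  f (fun i => Y (i, decide ((i : ℕ) < j))) - f (fun i => Y (i, decide ((i : ℕ) < j + 1)))

/-- The change of `f` when only coordinate `j` is replaced by its copy. -/
def singleDiff {ι : Type*} [DecidableEq ι] (f : (ι → E) → ℝ) (j : ι) (Y : ι × Bool → E) : ℝ :=
  f (fun i => Y (i, false)) - f (fun i => Y (i, decide (i = j)))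

/-- The random factor replacing the variance in Stein's method. -/
noncomputable def exchangeFactor (f : (Fin n → E) → ℝ) (Y : Fin n × Bool → E) : ℝ :=
  (1 / 2) * ∑ j, blockDiff f j Y * singleDiff f j Y

lemma abs_blockDiff_le {f : (Fin n → E) → ℝ} {C : ℝ} (hC : ∀ y, |f y| ≤ C) (j : Fin n)
    (Y : Fin n × Bool → E) : |blockDiff f j Y| ≤ 2 * C :=
  abs_sub_le_two_mul (hC _) (hC _)

lemma abs_singleDiff_le {ι : Type*} [DecidableEq ι] {f : (ι → E) → ℝ} {C : ℝ}
    (hC : ∀ y, |f y| ≤ C) (j : ι) (Y : ι × Bool → E) : |singleDiff f j Y| ≤ 2 * C :=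
  abs_sub_le_two_mul (hC _) (hC _)

lemma abs_exchangeFactor_le {f : (Fin n → E) → ℝ} {C : ℝ} (hC : ∀ y, |f y| ≤ C)
    (Y : Fin n × Bool → E) : |exchangeFactor f Y| ≤ (1 / 2) * ∑ _j : Fin n, 2 * C * (2 * C) := by
  unfold exchangeFactor
  rw [abs_mul, abs_of_pos (by norm_num : (0 : ℝ) < 1 / 2)]
  refine mul_le_mul_of_nonneg_left ((Finset.abs_sum_le_sum_abs _ _).trans ?_) (by norm_num)
  exact Finset.sum_le_sum fun j _ =>
    abs_mul_le_mul_of_le (abs_blockDiff_le hC j Y) (abs_singleDiff_le hC j Y)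

lemma injective_select {ι : Type*} (A : ι → Bool) :
    Function.Injective fun i => (i, A i) := fun _ _ h => (Prod.ext_iff.mp h).1

lemma injective_flip {ι : Type*} (A : ι → Bool) :
    Function.Injective fun p : ι × Bool => (p.1, p.2 ^^ A p.1) := by
  rintro ⟨i, c⟩ ⟨j, e⟩ h
  simp only [Prod.mk.injEq] at h
  obtain ⟨rfl, h⟩ := h
  simpa using h

variable [MeasurableSpace E] (μ : Measure E) [IsProbabilityMeasure μ]

@[fun_prop]
lemma measurable_blockDiff {f : (Fin n → E) → ℝ} (hf : Measurable f) (j : Fin n) :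
    Measurable (blockDiff f j) := by
  unfold blockDiff
  exact (hf.comp (by fun_prop)).sub (hf.comp (by fun_prop))

@[fun_prop]
lemma measurable_singleDiff {ι : Type*} [DecidableEq ι] {f : (ι → E) → ℝ} (hf : Measurable f)
    (j : ι) : Measurable (singleDiff f j) := by
  unfold singleDiff
  exact (hf.comp (by fun_prop)).sub (hf.comp (by fun_prop))

lemma measurable_exchangeFactor {f : (Fin n → E) → ℝ} (hf : Measurable f) :
    Measurable (exchangeFactor f) := by
  unfold exchangeFactor
  fun_prop

/-- Swapping originals with copies on the index set where `A` is true only permutes an i.i.d.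
family. All exchange symmetries below are instances of this. -/
lemma integral_flip {ι : Type*} [Fintype ι] (A : ι → Bool) {F : (ι × Bool → E) → ℝ}
    (hF : Measurable F) :
    ∫ Y : ι × Bool → E, F (fun p => Y (p.1, p.2 ^^ A p.1)) ∂(Measure.pi fun _ => μ)
      = ∫ Y, F Y ∂(Measure.pi fun _ => μ) :=
  integral_comp_injective μ (injective_flip A) hF

/-- The original and the copied coordinates are independent. -/
lemma integral_mul_copy {ι : Type*} [Fintype ι] {f g : (ι → E) → ℝ} (hf : Measurable f)
    (hg : Measurable g) :
    ∫ Y : ι × Bool → E, f (fun i => Y (i, true)) * g (fun i => Y (i, false))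
        ∂(Measure.pi fun _ => μ)
      = (∫ y, f y ∂(Measure.pi fun _ => μ)) * ∫ y, g y ∂(Measure.pi fun _ => μ) := by
  classical
  have h1 : iIndepFun (fun (k : ι × Bool) (Y : ι × Bool → E) => Y k) (Measure.pi fun _ => μ) :=
    iIndepFun_pi (X := fun _ => id) fun _ => aemeasurable_id
  have hd : Disjoint (Finset.univ.filter fun k : ι × Bool => k.2 = true)
      (Finset.univ.filter fun k : ι × Bool => k.2 = false) := by
    rw [Finset.disjoint_filter]
    intro k _ h
    simp [h]
  have h2 := h1.indepFun_finset _ _ hd fun k => measurable_pi_apply k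
  have h3 := h2.comp (φ := fun y => f fun i => y ⟨(i, true), by simp⟩)
    (ψ := fun y => g fun i => y ⟨(i, false), by simp⟩)
    (hf.comp (measurable_pi_lambda _ fun _ => measurable_pi_apply _))
    (hg.comp (measurable_pi_lambda _ fun _ => measurable_pi_apply _))
  have h4 := h3.integral_fun_mul_eq_mul_integral
    ((hf.comp (by fun_prop)).comp (by fun_prop)).aestronglyMeasurable
    ((hg.comp (by fun_prop)).comp (by fun_prop)).aestronglyMeasurable
  simp only [Function.comp_def] at h4
  rw [h4, integral_comp_injective μ (injective_select fun _ => true) hf,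
    integral_comp_injective μ (injective_select fun _ => false) hg]

/-- Covariance of two functions of independent variables through coordinatewise exchanges. -/
theorem covariance_eq_sum_blockDiff_mul_singleDiff {f g : (Fin n → E) → ℝ} (hf : Measurable f)
    (hg : Measurable g) {C D : ℝ} (hC : ∀ y, |f y| ≤ C) (hD : ∀ y, |g y| ≤ D) :
    ∫ y, f y * g y ∂(Measure.pi fun _ => μ)
        - (∫ y, f y ∂(Measure.pi fun _ => μ)) * ∫ y, g y ∂(Measure.pi fun _ => μ)
      = (1 / 2) * ∑ j, ∫ Y, blockDiff f j Y * singleDiff g j Y ∂(Measure.pi fun _ => μ) := by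
  set ν : Measure (Fin n × Bool → E) := Measure.pi fun _ => μ with hν
  have hg0 : Measurable fun Y : Fin n × Bool → E => g fun i => Y (i, false) :=
    hg.comp (by fun_prop)
  have hf0 : Measurable fun Y : Fin n × Bool → E => f fun i => Y (i, false) :=
    hf.comp (by fun_prop)
  have hf1 : Measurable fun Y : Fin n × Bool → E => f fun i => Y (i, true) :=
    hf.comp (by fun_prop)
  -- The block differences telescope from the original vector to its full copy.
  have htel : ∀ Y : Fin n × Bool → E, ∑ j, blockDiff f j Y
      = f (fun i => Y (i, false)) - f (fun i => Y (i, true)) := fun Y => by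
    have h := Fin.sum_univ_eq_sum_range (fun k : ℕ => f (fun i : Fin n => Y (i, decide ((i : ℕ) < k)))
      - f (fun i => Y (i, decide ((i : ℕ) < k + 1)))) n
    unfold blockDiff
    rw [h, Finset.sum_range_sub']
    simp
  -- Swapping coordinate `j` with its copy negates the block difference and turns `g(X)` into
  -- `g(X^j)`. Averaging the two expressions produces the factor `1/2` and the single difference of
  -- `g`.
  have hterm : ∀ j, ∫ Y, blockDiff f j Y * g (fun i => Y (i, false)) ∂ν
      = (1 / 2) * ∫ Y, blockDiff f j Y * singleDiff g j Y ∂ν := fun j => by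
    have hgj : Measurable fun Y : Fin n × Bool → E => g fun i => Y (i, decide (i = j)) :=
      hg.comp (by fun_prop)
    have h1 := integral_flip μ (fun i => decide (i = j))
      (F := fun Y : Fin n × Bool → E => blockDiff f j Y * g (fun i => Y (i, false)))
      ((measurable_blockDiff hf j).mul hg0)
    have h2 : ∀ Y : Fin n × Bool → E,
        blockDiff f j (fun p => Y (p.1, p.2 ^^ decide (p.1 = j))) = -blockDiff f j Y := fun Y => by
      unfold blockDiff
      have e1 : ∀ i : Fin n, (decide ((i : ℕ) < j) ^^ decide (i = j)) = decide ((i : ℕ) < j + 1) :=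
        fun i => by
          by_cases h : i = j
          · simp [h]
          · have : (i : ℕ) ≠ j := fun h' => h (Fin.ext h')
            simp only [h, decide_false, Bool.xor_false]
            congr 1
            apply propext
            omega
      have e2 : ∀ i : Fin n, (decide ((i : ℕ) < j + 1) ^^ decide (i = j)) = decide ((i : ℕ) < j) :=
        fun i => by rw [← e1 i]; simp
      simp only [e1, e2]
      ring
    simp only [h2, Bool.false_xor] at h1
    have i1 : Integrable (fun Y : Fin n × Bool → E => blockDiff f j Y * g (fun i => Y (i, false))) ν :=
      integrable_of_measurable_of_abs_le ((measurable_blockDiff hf j).mul hg0)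
        fun Y => abs_mul_le_mul_of_le (abs_blockDiff_le hC j Y) (hD _)
    have i2 : Integrable
        (fun Y : Fin n × Bool → E => blockDiff f j Y * g (fun i => Y (i, decide (i = j)))) ν :=
      integrable_of_measurable_of_abs_le ((measurable_blockDiff hf j).mul hgj)
        fun Y => abs_mul_le_mul_of_le (abs_blockDiff_le hC j Y) (hD _)
    simp only [neg_mul, integral_neg] at h1
    have h3 : ∫ Y, blockDiff f j Y * singleDiff g j Y ∂ν
        = ∫ Y, blockDiff f j Y * g (fun i => Y (i, false)) ∂ν
          - ∫ Y, blockDiff f j Y * g (fun i => Y (i, decide (i = j))) ∂ν := by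
      rw [← integral_sub i1 i2]
      simp only [singleDiff, mul_sub]
    rw [h3]
    linarith
  rw [Finset.mul_sum, ← Finset.sum_congr rfl fun j _ => hterm j, ← integral_finsetSum]
  · simp_rw [← Finset.sum_mul, htel, sub_mul]
    rw [integral_sub, integral_mul_copy μ hf hg]
    · congr 1
      exact (integral_comp_injective μ (injective_select fun _ => false) (hf.mul hg)).symm
    · exact integrable_of_measurable_of_abs_le (hf0.mul hg0)
        fun Y => abs_mul_le_mul_of_le (hC _) (hD _)
    · exact integrable_of_measurable_of_abs_le (hf1.mul hg0)
        fun Y => abs_mul_le_mul_of_le (hC _) (hD _)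
  · exact fun j _ => integrable_of_measurable_of_abs_le ((measurable_blockDiff hf j).mul hg0)
        fun Y => abs_mul_le_mul_of_le (abs_blockDiff_le hC j Y) (hD _)

/-- Block differences and single differences have the same distribution. -/
lemma integral_comp_blockDiff {f : (Fin n → E) → ℝ} (hf : Measurable f) {h : ℝ → ℝ}
    (hh : Measurable h) (j : Fin n) :
    ∫ Y, h (blockDiff f j Y) ∂(Measure.pi fun _ => μ)
      = ∫ Y, h (singleDiff f j Y) ∂(Measure.pi fun _ => μ) := by
  -- Swapping the coordinates before `j` undoes the earlier replacements.
  rw [← integral_flip μ (fun i : Fin n => decide ((i : ℕ) < j))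
    (F := fun Y => h (blockDiff f j Y)) (hh.comp (measurable_blockDiff hf j))]
  have e1 : ∀ i : Fin n,
      (decide ((i : ℕ) < j + 1) ^^ decide ((i : ℕ) < j)) = decide (i = j) := fun i => by
    by_cases h : i = j
    · simp [h]
    · have : (i : ℕ) ≠ j := fun h' => h (Fin.ext h')
      have h2 : (i : ℕ) < j + 1 ↔ (i : ℕ) < j := by omega
      simp [h2, h]
  simp only [blockDiff, singleDiff, e1, Bool.xor_self]

/-- Take `g = f` in the covariance formula, bound each product by half the sum of squares, and use
that both factors have the same law. -/
lemma efronStein_fin {f : (Fin n → E) → ℝ} (hf : Measurable f) {C : ℝ} (hC : ∀ y, |f y| ≤ C) :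
    ∫ y, f y ^ 2 ∂(Measure.pi fun _ => μ) - (∫ y, f y ∂(Measure.pi fun _ => μ)) ^ 2
      ≤ (1 / 2) * ∑ j, ∫ Y, singleDiff f j Y ^ 2 ∂(Measure.pi fun _ => μ) := by
  have h := covariance_eq_sum_blockDiff_mul_singleDiff μ hf hf hC hC
  simp only [← sq] at h
  rw [h]
  refine mul_le_mul_of_nonneg_left (Finset.sum_le_sum fun j _ => ?_) (by norm_num)
  have hb : Integrable (fun Y => blockDiff f j Y ^ 2) (Measure.pi fun _ : Fin n × Bool => μ) :=
    integrable_of_measurable_of_abs_le (C := 2 * C * (2 * C)) (by fun_prop) fun Y => by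
      rw [sq]
      exact abs_mul_le_mul_of_le (abs_blockDiff_le hC j Y) (abs_blockDiff_le hC j Y)
  have hs : Integrable (fun Y => singleDiff f j Y ^ 2) (Measure.pi fun _ : Fin n × Bool => μ) :=
    integrable_of_measurable_of_abs_le (C := 2 * C * (2 * C)) (by fun_prop) fun Y => by
      rw [sq]
      exact abs_mul_le_mul_of_le (abs_singleDiff_le hC j Y) (abs_singleDiff_le hC j Y)
  calc ∫ Y, blockDiff f j Y * singleDiff f j Y ∂(Measure.pi fun _ => μ)
      ≤ ∫ Y, (blockDiff f j Y ^ 2 + singleDiff f j Y ^ 2) / 2 ∂(Measure.pi fun _ => μ) := by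
        refine integral_mono (integrable_of_measurable_of_abs_le (by fun_prop) fun Y =>
          abs_mul_le_mul_of_le (abs_blockDiff_le hC j Y) (abs_singleDiff_le hC j Y))
          ((hb.add hs).div_const 2) fun Y => ?_
        simp only
        nlinarith [sq_nonneg (blockDiff f j Y - singleDiff f j Y)]
    _ = ∫ Y, singleDiff f j Y ^ 2 ∂(Measure.pi fun _ => μ) := by
        rw [integral_div, integral_add hb hs,
          integral_comp_blockDiff μ hf (h := fun x => x ^ 2) (by fun_prop) j]
        ring

/-- The Efron–Stein inequality for bounded functions. -/
theorem efronStein {ι : Type*} [Fintype ι] [DecidableEq ι] {f : (ι → E) → ℝ} (hf : Measurable f)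
    {C : ℝ} (hC : ∀ y, |f y| ≤ C) :
    ∫ y, f y ^ 2 ∂(Measure.pi fun _ => μ) - (∫ y, f y ∂(Measure.pi fun _ => μ)) ^ 2
      ≤ (1 / 2) * ∑ j, ∫ Y, singleDiff f j Y ^ 2 ∂(Measure.pi fun _ => μ) := by
  -- The telescoping needs an order on the coordinates, whereas single differences do not; hence the
  -- transfer from `Fin`.
  set e := Fintype.equivFin ι
  have hg : Measurable fun y : Fin (Fintype.card ι) → E => f fun i => y (e i) :=
    hf.comp (by fun_prop)
  have h := efronStein_fin μ hg fun y => hC _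
  rw [integral_comp_injective μ e.injective (hf.pow_const 2), integral_comp_injective μ e.injective hf]
    at h
  refine h.trans_eq ?_
  congr 1
  refine (Fintype.sum_equiv e _ _ fun j => ?_).symm
  rw [← integral_comp_injective μ (σ := fun p : ι × Bool => (e p.1, p.2))
    (by
      rintro ⟨i, c⟩ ⟨k, d⟩ h
      simpa using h) ((measurable_singleDiff hf j).pow_const 2)]
  simp [singleDiff]

end Exchange

/-! ### Stein's method for functions of independent variables. -/

/-- First-order Taylor bound for a function whose derivative is Lipschitz. -/
lemma abs_sub_sub_deriv_mul_le {φ φ' φ'' : ℝ → ℝ} {c : ℝ} (h1 : ∀ x, HasDerivAt φ (φ' x) x)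
    (h2 : ∀ x, HasDerivAt φ' (φ'' x) x) (hc : ∀ x, |φ'' x| ≤ c) (u v : ℝ) :
    |φ u - φ v - φ' u * (u - v)| ≤ c * (u - v) ^ 2 := by
  have hlip : ∀ x y, |φ' x - φ' y| ≤ c * |x - y| := fun x y => by
    have := Convex.norm_image_sub_le_of_norm_hasDerivWithin_le (f := φ') (f' := φ'')
      (s := Set.univ) (C := c) (x := y) (y := x) (fun x _ => (h2 x).hasDerivWithinAt)
      (fun x _ => by simpa using hc x) convex_univ trivial trivial
    simpa using this
  have hc0 : 0 ≤ c := (abs_nonneg _).trans (hc 0)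
  have h := Convex.norm_image_sub_le_of_norm_hasDerivWithin_le (f := fun x => φ x - φ' u * x)
    (f' := fun x => φ' x - φ' u) (s := Set.uIcc u v) (C := c * |u - v|) (x := v) (y := u)
    (fun x _ => ((h1 x).sub (((hasDerivAt_id x).const_mul (φ' u)).congr_deriv
      (mul_one _))).hasDerivWithinAt)
    (fun x hx => (hlip x u).trans (mul_le_mul_of_nonneg_left (by
      rw [abs_sub_comm u v]
      exact Set.abs_sub_left_of_mem_uIcc hx) hc0)) (convex_uIcc _ _)
    Set.right_mem_uIcc Set.left_mem_uIcc
  simp only [Real.norm_eq_abs] at h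
  rw [mul_assoc, ← sq, sq_abs] at h
  refine le_trans (le_of_eq ?_) h
  congr 1
  ring

/-- The Cauchy–Schwarz inequality, obtained by integrating `(|T - m| - a)² ≥ 0` with `a` the mean of
`|T - m|`. -/
lemma integral_abs_sub_le_sqrt {Ω : Type*} [MeasurableSpace Ω] {P : Measure Ω}
    [IsProbabilityMeasure P] {T : Ω → ℝ} (hT : Measurable T) {C : ℝ} (hC : ∀ ω, |T ω| ≤ C) :
    ∫ ω, |T ω - ∫ ω, T ω ∂P| ∂P ≤ √(∫ ω, T ω ^ 2 ∂P - (∫ ω, T ω ∂P) ^ 2) := by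
  set m := ∫ ω, T ω ∂P with hm
  have hTi : Integrable T P := integrable_of_measurable_of_abs_le hT hC
  have hT2 : Integrable (fun ω => T ω ^ 2) P :=
    integrable_of_measurable_of_abs_le (C := C * C) (hT.pow_const 2) fun ω => by
      rw [sq]
      exact abs_mul_le_mul_of_le (hC ω) (hC ω)
  set a := ∫ ω, |T ω - m| ∂P with ha
  have hai : Integrable (fun ω => |T ω - m|) P := (hTi.sub (integrable_const m)).abs
  have hsq : ∫ ω, (T ω - m) ^ 2 ∂P = ∫ ω, T ω ^ 2 ∂P - m ^ 2 := by
    have : ∀ ω, (T ω - m) ^ 2 = T ω ^ 2 - (2 * m * T ω - m ^ 2) := fun ω => by ring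
    simp_rw [this]
    rw [integral_sub hT2 (by exact (hTi.const_mul _).sub (integrable_const _)),
      integral_sub (hTi.const_mul _) (integrable_const _), integral_const_mul, ← hm]
    simp
    ring
  have hsqi : Integrable (fun ω => (T ω - m) ^ 2) P := by
    have : (fun ω => (T ω - m) ^ 2) = fun ω => T ω ^ 2 - (2 * m * T ω - m ^ 2) := by
      funext ω; ring
    rw [this]
    exact hT2.sub ((hTi.const_mul _).sub (integrable_const _))
  have h : ∫ ω, (2 * a * |T ω - m| - a ^ 2) ∂P ≤ ∫ ω, (T ω - m) ^ 2 ∂P := by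
    refine integral_mono ((hai.const_mul _).sub (integrable_const _)) hsqi fun ω => ?_
    simp only
    nlinarith [sq_nonneg (|T ω - m| - a), sq_abs (T ω - m)]
  rw [integral_sub (hai.const_mul _) (integrable_const _), integral_const_mul, ← ha, hsq] at h
  simp only [integral_const, probReal_univ, one_smul] at h
  exact Real.le_sqrt_of_sq_le (by nlinarith)

section SteinExchange

variable {E : Type*} {n : ℕ} [MeasurableSpace E] (μ : Measure E) [IsProbabilityMeasure μ]

lemma integral_exchangeFactor {f : (Fin n → E) → ℝ} (hf : Measurable f) {C : ℝ}
    (hC : ∀ y, |f y| ≤ C) :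
    ∫ Y, exchangeFactor f Y ∂(Measure.pi fun _ => μ)
      = ∫ y, f y ^ 2 ∂(Measure.pi fun _ => μ) - (∫ y, f y ∂(Measure.pi fun _ => μ)) ^ 2 := by
  have h := covariance_eq_sum_blockDiff_mul_singleDiff μ hf hf hC hC
  simp only [← sq] at h
  rw [h]
  unfold exchangeFactor
  rw [integral_const_mul, integral_finsetSum]
  exact fun j _ => integrable_of_measurable_of_abs_le (by fun_prop) fun Y =>
    abs_mul_le_mul_of_le (abs_blockDiff_le hC j Y) (abs_singleDiff_le hC j Y)

/-- The Stein discrepancy of a standardized function of independent variables. -/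
theorem integral_stein_le {f : (Fin n → E) → ℝ} (hf : Measurable f) {C : ℝ}
    (hC : ∀ y, |f y| ≤ C) (h0 : ∫ y, f y ∂(Measure.pi fun _ => μ) = 0)
    (h1 : ∫ y, f y ^ 2 ∂(Measure.pi fun _ => μ) = 1) {φ φ' φ'' : ℝ → ℝ}
    (hφ : ∀ x, HasDerivAt φ (φ' x) x) (hφ' : ∀ x, HasDerivAt φ' (φ'' x) x)
    (b0 : ∀ x, |φ x| ≤ 3) (b1 : ∀ x, |φ' x| ≤ 8) (b2 : ∀ x, |φ'' x| ≤ 12) :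
    ∫ y, (φ' (f y) - f y * φ (f y)) ∂(Measure.pi fun _ => μ)
      ≤ 8 * √(∫ Y, exchangeFactor f Y ^ 2 ∂(Measure.pi fun _ => μ)
          - (∫ Y, exchangeFactor f Y ∂(Measure.pi fun _ => μ)) ^ 2)
        + 12 * ∑ j, ∫ Y, |singleDiff f j Y| ^ 3 ∂(Measure.pi fun _ => μ) := by
  set ν : Measure (Fin n × Bool → E) := Measure.pi fun _ => μ with hν
  have hφm : Measurable φ :=
    (continuous_iff_continuousAt.mpr fun x => (hφ x).continuousAt).measurable
  have hφ'm : Measurable φ' :=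
    (continuous_iff_continuousAt.mpr fun x => (hφ' x).continuousAt).measurable
  have hfs : Measurable fun Y : Fin n × Bool → E => f fun i => Y (i, false) :=
    hf.comp (by fun_prop)
  have hT1 : ∫ Y, exchangeFactor f Y ∂ν = 1 := by
    rw [integral_exchangeFactor μ hf hC, h0, h1]
    norm_num
  have hcov := covariance_eq_sum_blockDiff_mul_singleDiff μ hf (hφm.comp hf) hC fun y => b0 _
  rw [h0, zero_mul, sub_zero] at hcov
  have hTm := measurable_exchangeFactor hf
  have hTb := abs_exchangeFactor_le hC
  have hTi : Integrable (exchangeFactor f) ν := integrable_of_measurable_of_abs_le hTm hTb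
  have hφT : Integrable (fun Y => φ' (f fun i => Y (i, false)) * exchangeFactor f Y) ν :=
    integrable_of_measurable_of_abs_le ((hφ'm.comp hfs).mul hTm)
      fun Y => abs_mul_le_mul_of_le (b1 _) (hTb Y)
  have hφi : Integrable (fun Y : Fin n × Bool → E => φ' (f fun i => Y (i, false))) ν :=
    integrable_of_measurable_of_abs_le (hφ'm.comp hfs) fun Y => b1 _
  have hab : ∀ j, Integrable (fun Y => blockDiff f j Y * singleDiff (φ ∘ f) j Y) ν := fun j =>
    integrable_of_measurable_of_abs_le ((measurable_blockDiff hf j).mul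
      (measurable_singleDiff (hφm.comp hf) j))
      fun Y => abs_mul_le_mul_of_le (abs_blockDiff_le hC j Y) (abs_singleDiff_le (fun y => b0 _) j Y)
  have hcube : ∀ {F : (Fin n × Bool → E) → ℝ}, Measurable F → (∀ Y, |F Y| ≤ 2 * C) →
      Integrable (fun Y => |F Y| ^ 3) ν := fun {F} hF hb =>
    integrable_of_measurable_of_abs_le (C := (2 * C) ^ 3) (by fun_prop) fun Y => by
      rw [abs_pow, abs_abs]
      exact pow_le_pow_left₀ (abs_nonneg _) (hb Y) 3
  have hbi : ∀ j, Integrable (fun Y => |singleDiff f j Y| ^ 3) ν := fun j =>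
    hcube (measurable_singleDiff hf j) (abs_singleDiff_le hC j)
  have hai : ∀ j, Integrable (fun Y => |blockDiff f j Y| ^ 3) ν := fun j =>
    hcube (measurable_blockDiff hf j) (abs_blockDiff_le hC j)
  have hpt : ∀ j Y, φ' (f fun i => Y (i, false)) * (blockDiff f j Y * singleDiff f j Y)
      - blockDiff f j Y * singleDiff (φ ∘ f) j Y
      ≤ 12 * (|blockDiff f j Y| ^ 3 + |singleDiff f j Y| ^ 3) := fun j Y => by
    have h := abs_sub_sub_deriv_mul_le hφ hφ' b2 (f fun i => Y (i, false))
      (f fun i => Y (i, decide (i = j)))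
    change |singleDiff (φ ∘ f) j Y - φ' (f fun i => Y (i, false)) * singleDiff f j Y|
      ≤ 12 * singleDiff f j Y ^ 2 at h
    set a := blockDiff f j Y
    set b := singleDiff f j Y
    set r := singleDiff (φ ∘ f) j Y
    set p := φ' (f fun i => Y (i, false))
    have e1 : p * (a * b) - a * r ≤ |a| * |r - p * b| := by
      rw [← abs_mul, ← abs_neg]
      refine le_trans (le_of_eq ?_) (le_abs_self _)
      ring
    have e2 : |a| * |r - p * b| ≤ |a| * (12 * b ^ 2) := mul_le_mul_of_nonneg_left h (abs_nonneg a)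
    -- Decoupling the block difference from the single one; their third moments agree because they
    -- have the same law.
    have e3 : |a| * |b| ^ 2 ≤ |a| ^ 3 + |b| ^ 3 := by
      rcases le_total |a| |b| with hle | hle
      · have := mul_le_mul_of_nonneg_right hle (sq_nonneg |b|)
        have h3 : 0 ≤ |a| ^ 3 := by positivity
        nlinarith
      · have := mul_le_mul_of_nonneg_left (pow_le_pow_left₀ (abs_nonneg b) hle 2) (abs_nonneg a)
        have h3 : 0 ≤ |b| ^ 3 := by positivity
        nlinarith
    rw [sq_abs] at e3
    linarith
  -- Replacing each difference of `φ ∘ f` by its linearization turns the covariance formula into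
  -- `E[φ'(f) T]`. The constant is `½ · 12 · 2`, the `2` coming from the two equal third moments.
  have hA : ∫ Y, φ' (f fun i => Y (i, false)) * exchangeFactor f Y ∂ν
      - ∫ y, f y * φ (f y) ∂(Measure.pi fun _ => μ)
      ≤ 12 * ∑ j, ∫ Y, |singleDiff f j Y| ^ 3 ∂ν := by
    have hcov' : ∫ y, f y * φ (f y) ∂(Measure.pi fun _ => μ)
        = ∫ Y, (1 / 2) * ∑ j, blockDiff f j Y * singleDiff (φ ∘ f) j Y ∂ν := by
      rw [integral_const_mul, integral_finsetSum _ fun j _ => hab j]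
      exact hcov
    have hsum : Integrable (fun Y => (1 / 2) * ∑ j, blockDiff f j Y * singleDiff (φ ∘ f) j Y) ν :=
      (integrable_finsetSum _ fun j _ => hab j).const_mul _
    have hcub : Integrable
        (fun Y => 6 * ∑ j, (|blockDiff f j Y| ^ 3 + |singleDiff f j Y| ^ 3)) ν :=
      (integrable_finsetSum _ fun j _ => (hai j).add (hbi j)).const_mul _
    rw [hcov', ← integral_sub hφT hsum]
    calc _ ≤ ∫ Y, 6 * ∑ j, (|blockDiff f j Y| ^ 3 + |singleDiff f j Y| ^ 3) ∂ν := by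
          refine integral_mono (hφT.sub hsum) hcub fun Y => ?_
          simp only
          have := Finset.sum_le_sum fun j (_ : j ∈ Finset.univ) => hpt j Y
          rw [Finset.sum_sub_distrib, ← Finset.mul_sum, ← Finset.mul_sum] at this
          unfold exchangeFactor
          linarith
      _ = 12 * ∑ j, ∫ Y, |singleDiff f j Y| ^ 3 ∂ν := by
          rw [integral_const_mul, integral_finsetSum _ fun j _ => by exact (hai j).add (hbi j)]
          have : ∀ j, ∫ Y, (|blockDiff f j Y| ^ 3 + |singleDiff f j Y| ^ 3) ∂ν
              = 2 * ∫ Y, |singleDiff f j Y| ^ 3 ∂ν := fun j => by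
            rw [integral_add (hai j) (hbi j),
              integral_comp_blockDiff μ hf (h := fun x => |x| ^ 3) (by fun_prop) j]
            ring
          simp_rw [this]
          rw [← Finset.mul_sum]
          ring
  -- Since `T` has mean one, `E[φ'(f) (1 - T)]` costs at most `8 E|T - 1|`.
  have hB : ∫ y, φ' (f y) ∂(Measure.pi fun _ => μ)
      - ∫ Y, φ' (f fun i => Y (i, false)) * exchangeFactor f Y ∂ν
      ≤ 8 * √(∫ Y, exchangeFactor f Y ^ 2 ∂ν - (∫ Y, exchangeFactor f Y ∂ν) ^ 2) := by
    have hsq := integral_abs_sub_le_sqrt (P := ν) hTm hTb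
    rw [hT1] at hsq ⊢
    rw [← integral_comp_injective μ (injective_select fun _ : Fin n => false)
      (F := fun y => φ' (f y)) (hφ'm.comp hf)]
    rw [← integral_sub hφi hφT]
    calc _ ≤ ∫ Y, 8 * |exchangeFactor f Y - 1| ∂ν := by
          refine integral_mono (hφi.sub hφT)
            ((hTi.sub (integrable_const 1)).abs.const_mul 8) fun Y => ?_
          simp only
          have h := abs_mul_le_mul_of_le (b1 (f fun i => Y (i, false)))
            (le_refl |exchangeFactor f Y - 1|)
          have := neg_abs_le (φ' (f fun i => Y (i, false)) * (exchangeFactor f Y - 1))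
          linarith
      _ ≤ _ := by
          rw [integral_const_mul]
          exact mul_le_mul_of_nonneg_left hsq (by norm_num)
  have hi1 : Integrable (fun y => φ' (f y)) (Measure.pi fun _ : Fin n => μ) :=
    integrable_of_measurable_of_abs_le (hφ'm.comp hf) fun Y => b1 _
  have hi2 : Integrable (fun y => f y * φ (f y)) (Measure.pi fun _ : Fin n => μ) :=
    integrable_of_measurable_of_abs_le (hf.mul (hφm.comp hf))
      fun Y => abs_mul_le_mul_of_le (hC _) (b0 _)
  rw [integral_sub hi1 hi2]
  linarith

/-- Normal approximation for a standardized bounded function of i.i.d. variables. -/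
theorem wassersteinDist_map_le {f : (Fin n → E) → ℝ} (hf : Measurable f) {C : ℝ}
    (hC : ∀ y, |f y| ≤ C) (h0 : ∫ y, f y ∂(Measure.pi fun _ => μ) = 0)
    (h1 : ∫ y, f y ^ 2 ∂(Measure.pi fun _ => μ) = 1) :
    wassersteinDist ((Measure.pi fun _ => μ).map f) (gaussianReal 0 1) ≤
      ENNReal.ofReal (8 * √(∫ Y, exchangeFactor f Y ^ 2 ∂(Measure.pi fun _ => μ)
          - (∫ Y, exchangeFactor f Y ∂(Measure.pi fun _ => μ)) ^ 2)
        + 12 * ∑ j, ∫ Y, |singleDiff f j Y| ^ 3 ∂(Measure.pi fun _ => μ)) := by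
  have := Measure.isProbabilityMeasure_map (μ := Measure.pi fun _ : Fin n => μ) hf.aemeasurable
  refine wassersteinDist_gaussianReal_le _ ?_ fun φ φ' φ'' hφ hφ' b0 b1 b2 => ?_
  · rw [integrable_map_measure (by fun_prop) hf.aemeasurable]
    refine integrable_of_measurable_of_abs_le (C := C * C) (by fun_prop) fun y => ?_
    simp only [Function.comp_apply, sq]
    exact abs_mul_le_mul_of_le (hC y) (hC y)
  · have hφc : Continuous φ := continuous_iff_continuousAt.mpr fun x => (hφ x).continuousAt
    have hφ'c : Continuous φ' := continuous_iff_continuousAt.mpr fun x => (hφ' x).continuousAt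
    rw [integral_map hf.aemeasurable (Continuous.aestronglyMeasurable (by fun_prop))]
    exact integral_stein_le μ hf hC h0 h1 hφ hφ' b0 b1 b2

end SteinExchange

/-! ### Locality of the total: the effect of inserting or moving one point. -/

section Local

variable {E : Type*} [PseudoMetricSpace E] [DecidableEq E]

/-- The total `∑ x ∈ A, ψ x A` of a functional over a finite configuration. -/
noncomputable def totalSum (ψ : E → Finset E → ℝ) (A : Finset E) : ℝ := ∑ x ∈ A, ψ x A

/-- `ψ x 𝒳` depends only on the points of `𝒳` within distance `ρ` of `x`. -/
def IsLocalFunctional (ψ : E → Finset E → ℝ) (ρ : ℝ) : Prop :=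
  ∀ (x : E) (𝒳 𝒴 : Finset E), (∀ y, dist x y ≤ ρ → (y ∈ 𝒳 ↔ y ∈ 𝒴)) → ψ x 𝒳 = ψ x 𝒴

variable {ψ : E → Finset E → ℝ} {ρ B : ℝ}

/-- Only the summands at points within `ρ` of `p` can see `p`. -/
lemma IsLocalFunctional.totalSum_insert_sub (hloc : IsLocalFunctional ψ ρ) {p : E} {A : Finset E}
    (hp : p ∉ A) :
    totalSum ψ (insert p A) - totalSum ψ A
      = ψ p (insert p A) + ∑ x ∈ A with dist p x ≤ ρ, (ψ x (insert p A) - ψ x A) := by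
  unfold totalSum
  rw [Finset.sum_insert hp, add_sub_assoc, ← Finset.sum_sub_distrib, Finset.sum_filter]
  congr 1
  refine Finset.sum_congr rfl fun x _ => ?_
  split_ifs with h
  · rfl
  · rw [sub_eq_zero]
    refine hloc x _ _ fun y hy => ?_
    have : y ≠ p := fun e => h (by rwa [e, dist_comm] at hy)
    simp [this]

/-- Adding a point changes the total by at most `2 B` times the number of its neighbours. -/
lemma IsLocalFunctional.abs_totalSum_insert_sub_le (hloc : IsLocalFunctional ψ ρ) (hρ : 0 ≤ ρ)
    (hB : ∀ x 𝒳, |ψ x 𝒳| ≤ B) (p : E) (A : Finset E) :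
    |totalSum ψ (insert p A) - totalSum ψ A|
      ≤ 2 * B * ((insert p A).filter fun y => dist p y ≤ ρ).card := by
  have hB0 : 0 ≤ B := (abs_nonneg _).trans (hB p A)
  by_cases hp : p ∈ A
  · rw [Finset.insert_eq_of_mem hp, sub_self, abs_zero]
    positivity
  · rw [hloc.totalSum_insert_sub hp, Finset.filter_insert, if_pos (by simpa using hρ),
      Finset.card_insert_of_notMem (by simp [hp])]
    have h1 : |∑ x ∈ A with dist p x ≤ ρ, (ψ x (insert p A) - ψ x A)|
        ≤ ∑ x ∈ A with dist p x ≤ ρ, 2 * B :=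
      (Finset.abs_sum_le_sum_abs _ _).trans
        (Finset.sum_le_sum fun x _ => abs_sub_le_two_mul (hB _ _) (hB _ _))
    rw [Finset.sum_const, nsmul_eq_mul] at h1
    have h2 := (abs_add_le (ψ p (insert p A))
      (∑ x ∈ A with dist p x ≤ ρ, (ψ x (insert p A) - ψ x A))).trans (add_le_add (hB _ _) h1)
    push_cast
    linarith

/-- The cost of adding a point depends only on the configuration within distance `2 ρ`. -/
lemma IsLocalFunctional.totalSum_insert_sub_congr (hloc : IsLocalFunctional ψ ρ) (hρ : 0 ≤ ρ)
    {p : E} {A A' : Finset E} (h : ∀ y, dist p y ≤ 2 * ρ → (y ∈ A ↔ y ∈ A')) :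
    totalSum ψ (insert p A) - totalSum ψ A = totalSum ψ (insert p A') - totalSum ψ A' := by
  have hpp : p ∈ A ↔ p ∈ A' := h p (by rw [dist_self]; positivity)
  by_cases hp : p ∈ A
  · rw [Finset.insert_eq_of_mem hp, Finset.insert_eq_of_mem (hpp.mp hp), sub_self, sub_self]
  · rw [hloc.totalSum_insert_sub hp, hloc.totalSum_insert_sub (mt hpp.mpr hp)]
    have hf : (A.filter fun x => dist p x ≤ ρ) = A'.filter fun x => dist p x ≤ ρ := by
      ext x
      simp only [Finset.mem_filter]
      refine and_congr_left fun hx => h x (by linarith)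
    rw [hf]
    congr 1
    · refine hloc _ _ _ fun y hy => ?_
      rw [Finset.mem_insert, Finset.mem_insert, h y (by linarith)]
    · refine Finset.sum_congr rfl fun x hx => ?_
      have hx : dist p x ≤ ρ := (Finset.mem_filter.mp hx).2
      have hxy : ∀ y, dist x y ≤ ρ → (y ∈ A ↔ y ∈ A') := fun y hy =>
        h y ((dist_triangle p x y).trans (by linarith))
      congr 1
      · refine hloc _ _ _ fun y hy => ?_
        rw [Finset.mem_insert, Finset.mem_insert, hxy y hy]
      · exact hloc _ _ _ hxy

variable {ι : Type*} [Fintype ι] [DecidableEq ι]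

/-- The total of `ψ` over the set of values of a vector. -/
noncomputable def vectorSum (ψ : E → Finset E → ℝ) (y : ι → E) : ℝ :=
  totalSum ψ (Finset.univ.image y)

omit [PseudoMetricSpace E] in
lemma image_univ_eq_insert (y : ι → E) (j : ι) :
    Finset.univ.image y = insert (y j) ((Finset.univ.erase j).image y) := by
  rw [← Finset.image_insert, Finset.insert_erase (Finset.mem_univ j)]

omit [PseudoMetricSpace E] in
lemma image_erase_congr {y y' : ι → E} {j : ι} (h : ∀ i, i ≠ j → y i = y' i) :
    (Finset.univ.erase j).image y = (Finset.univ.erase j).image y' :=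
  Finset.image_congr fun i hi => h i (Finset.ne_of_mem_erase hi)

-- Moving point `j` means deleting it and inserting it elsewhere. Deleting the index rather than the
-- value keeps this exact when coordinates coincide.
omit [PseudoMetricSpace E] in
lemma vectorSum_sub_eq {y y' : ι → E} {j : ι} (h : ∀ i, i ≠ j → y i = y' i) :
    vectorSum ψ y - vectorSum ψ y'
      = (totalSum ψ (insert (y j) ((Finset.univ.erase j).image y))
          - totalSum ψ ((Finset.univ.erase j).image y))
        - (totalSum ψ (insert (y' j) ((Finset.univ.erase j).image y'))
          - totalSum ψ ((Finset.univ.erase j).image y')) := by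
  unfold vectorSum
  rw [image_univ_eq_insert y j, image_univ_eq_insert y' j, image_erase_congr h]
  ring

lemma IsLocalFunctional.abs_vectorSum_sub_le (hloc : IsLocalFunctional ψ ρ) (hρ : 0 ≤ ρ)
    (hB : ∀ x 𝒳, |ψ x 𝒳| ≤ B) {y y' : ι → E} {j : ι} (h : ∀ i, i ≠ j → y i = y' i) :
    |vectorSum ψ y - vectorSum ψ y'|
      ≤ 2 * B * ((Finset.univ.filter fun i => dist (y j) (y i) ≤ ρ).card
        + (Finset.univ.filter fun i => dist (y' j) (y' i) ≤ ρ).card) := by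
  have hB0 : 0 ≤ B := (abs_nonneg _).trans (hB (y j) ∅)
  have hcard : ∀ z : ι → E, |totalSum ψ (insert (z j) ((Finset.univ.erase j).image z))
      - totalSum ψ ((Finset.univ.erase j).image z)|
      ≤ 2 * B * ((Finset.univ.filter fun i => dist (z j) (z i) ≤ ρ).card : ℝ) := fun z => by
    refine (hloc.abs_totalSum_insert_sub_le hρ hB _ _).trans ?_
    refine mul_le_mul_of_nonneg_left ?_ (by positivity)
    rw [← image_univ_eq_insert, Finset.filter_image]
    exact_mod_cast Finset.card_image_le
  rw [vectorSum_sub_eq h, mul_add]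
  exact (abs_sub _ _).trans (add_le_add (hcard y) (hcard y'))

/-- Each insertion cost sees only the ball of radius `2ρ` about the inserted point. Other
coordinates may therefore change freely, provided their old and new positions avoid the `2ρ`-balls
about both positions of point `j`. -/
lemma IsLocalFunctional.vectorSum_sub_congr (hloc : IsLocalFunctional ψ ρ) (hρ : 0 ≤ ρ)
    {y y' z z' : ι → E} {j : ι} (hy : ∀ i, i ≠ j → y i = y' i) (hz : ∀ i, i ≠ j → z i = z' i)
    (hj : y j = z j) (hj' : y' j = z' j)
    (h : ∀ i, i ≠ j → y i = z i ∨ (2 * ρ < dist (y j) (y i) ∧ 2 * ρ < dist (y j) (z i) ∧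
      2 * ρ < dist (y' j) (y i) ∧ 2 * ρ < dist (y' j) (z i))) :
    vectorSum ψ y - vectorSum ψ y' = vectorSum ψ z - vectorSum ψ z' := by
  rw [vectorSum_sub_eq hy, vectorSum_sub_eq hz, ← hj, ← hj', ← image_erase_congr hy,
    ← image_erase_congr hz]
  have key : ∀ p : E, (∀ i, i ≠ j → y i = z i ∨ (2 * ρ < dist p (y i) ∧ 2 * ρ < dist p (z i))) →
      ∀ x, dist p x ≤ 2 * ρ →
        (x ∈ (Finset.univ.erase j).image y ↔ x ∈ (Finset.univ.erase j).image z) := by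
    intro p hp x hx
    simp only [Finset.mem_image, Finset.mem_erase, Finset.mem_univ, and_true]
    constructor
    · rintro ⟨i, hi, rfl⟩
      rcases hp i hi with h | h
      · exact ⟨i, hi, h.symm⟩
      · exact absurd hx (not_le.mpr h.1)
    · rintro ⟨i, hi, rfl⟩
      rcases hp i hi with h | h
      · exact ⟨i, hi, h⟩
      · exact absurd hx (not_le.mpr h.2)
  congr 1
  · exact hloc.totalSum_insert_sub_congr hρ (key _ fun i hi => (h i hi).imp id fun h => ⟨h.1, h.2.1⟩)
  · exact hloc.totalSum_insert_sub_congr hρ (key _ fun i hi => (h i hi).imp id fun h => h.2.2)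

end Local

/-! ### Neighbour counts in the fourfold family of coordinates. -/

section Count

variable {E : Type*} [PseudoMetricSpace E] {κ ι : Type*} [Fintype κ] [Fintype ι]

/-- The number of coordinates of `Y` within distance `r` of coordinate `k`. -/
noncomputable def neighbourCount (r : ℝ) (Y : κ → E) (k : κ) : ℝ :=
  ∑ l, if dist (Y k) (Y l) ≤ r then 1 else 0

/-- The number of neighbours of the four copies of coordinate `j`. -/
noncomputable def cloneCount (r : ℝ) (Z : (ι × Bool) × Bool → E) (j : ι) : ℝ :=
  ∑ c, ∑ e, neighbourCount r Z ((j, c), e)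

/-- The coordinates one of whose copies is within distance `r` of a copy of coordinate `i`. -/
noncomputable def closeSet (r : ℝ) (Z : (ι × Bool) × Bool → E) (i : ι) : Finset ι :=
  open scoped Classical in
  Finset.univ.filter fun j => ∃ c e c' e', dist (Z ((j, c), e)) (Z ((i, c'), e')) ≤ r

lemma neighbourCount_nonneg (r : ℝ) (Y : κ → E) (k : κ) : 0 ≤ neighbourCount r Y k :=
  Finset.sum_nonneg fun l _ => by split_ifs <;> norm_num

lemma one_le_neighbourCount {r : ℝ} (hr : 0 ≤ r) (Y : κ → E) (k : κ) :
    1 ≤ neighbourCount r Y k := by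
  have h := Finset.single_le_sum (f := fun l => if dist (Y k) (Y l) ≤ r then (1 : ℝ) else 0)
    (fun l _ => by split_ifs <;> norm_num) (Finset.mem_univ k)
  refine le_trans ?_ h
  simp [hr]

lemma neighbourCount_le_card (r : ℝ) (Y : κ → E) (k : κ) :
    neighbourCount r Y k ≤ Fintype.card κ := by
  refine (Finset.sum_le_sum (g := fun _ => (1 : ℝ)) fun l _ => ?_).trans_eq (by simp)
  split_ifs <;> norm_num

lemma card_filter_le_neighbourCount {ρ r : ℝ} (hr : ρ ≤ r) {σ : ι → κ}
    (hσ : Function.Injective σ) (Y : κ → E) (j : ι) :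
    ((Finset.univ.filter fun i => dist (Y (σ j)) (Y (σ i)) ≤ ρ).card : ℝ)
      ≤ neighbourCount r Y (σ j) := by
  classical
  unfold neighbourCount
  rw [Finset.sum_boole]
  norm_cast
  rw [← Finset.card_image_of_injective _ hσ]
  refine Finset.card_le_card fun k hk => ?_
  obtain ⟨i, hi, rfl⟩ := Finset.mem_image.mp hk
  simp only [Finset.mem_filter, Finset.mem_univ, true_and] at hi ⊢
  exact hi.trans hr

lemma neighbourCount_le_cloneCount (r : ℝ) (Z : (ι × Bool) × Bool → E) (j : ι) (c e : Bool) :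
    neighbourCount r Z ((j, c), e) ≤ cloneCount r Z j :=
  (Finset.single_le_sum (f := fun e => neighbourCount r Z ((j, c), e))
    (fun _ _ => neighbourCount_nonneg _ _ _) (Finset.mem_univ e)).trans
    (Finset.single_le_sum (f := fun c => ∑ e, neighbourCount r Z ((j, c), e))
      (fun _ _ => Finset.sum_nonneg fun _ _ => neighbourCount_nonneg _ _ _) (Finset.mem_univ c))

lemma one_le_cloneCount {r : ℝ} (hr : 0 ≤ r) (Z : (ι × Bool) × Bool → E) (j : ι) :
    1 ≤ cloneCount r Z j :=
  (one_le_neighbourCount hr Z ((j, true), true)).trans (neighbourCount_le_cloneCount r Z j _ _)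

lemma mem_closeSet {r : ℝ} {Z : (ι × Bool) × Bool → E} {i j : ι} :
    j ∈ closeSet r Z i ↔ ∃ c e c' e', dist (Z ((j, c), e)) (Z ((i, c'), e')) ≤ r := by
  simp [closeSet]

lemma mem_closeSet_comm {r : ℝ} {Z : (ι × Bool) × Bool → E} {i j : ι} :
    j ∈ closeSet r Z i ↔ i ∈ closeSet r Z j := by
  have : ∀ i j : ι, j ∈ closeSet r Z i → i ∈ closeSet r Z j := fun i j h => by
    obtain ⟨c, e, c', e', h⟩ := mem_closeSet.mp h
    exact mem_closeSet.mpr ⟨c', e', c, e, by rwa [dist_comm]⟩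
  exact ⟨this i j, this j i⟩

/-- Every close index contributes at least one of its copies to the neighbours of some copy of `i`.
-/
lemma card_closeSet_le (r : ℝ) (Z : (ι × Bool) × Bool → E) (i : ι) :
    ((closeSet r Z i).card : ℝ) ≤ cloneCount r Z i := by
  set s : Bool × Bool → Finset ((ι × Bool) × Bool) := fun q =>
    Finset.univ.filter fun l => dist (Z ((i, q.1), q.2)) (Z l) ≤ r with hs
  classical
  have hsub : closeSet r Z i ⊆ Finset.univ.biUnion fun q => (s q).image fun l => l.1.1 := by
    intro j hj
    obtain ⟨c, e, c', e', h⟩ := mem_closeSet.mp hj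
    refine Finset.mem_biUnion.mpr ⟨(c', e'), Finset.mem_univ _, Finset.mem_image.mpr
      ⟨((j, c), e), ?_, rfl⟩⟩
    simpa [hs, dist_comm] using h
  have h1 : (closeSet r Z i).card ≤ ∑ q, (s q).card :=
    (Finset.card_le_card hsub).trans (Finset.card_biUnion_le.trans
      (Finset.sum_le_sum fun q _ => Finset.card_image_le))
  have h2 : cloneCount r Z i = ∑ q, ((s q).card : ℝ) := by
    unfold cloneCount neighbourCount
    rw [Fintype.sum_prod_type]
    simp only [hs, Finset.sum_boole]
  rw [h2]
  exact_mod_cast h1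

/-- Double counting of a sum of local contributions over close pairs. -/
lemma sum_sq_sum_closeSet_le {r : ℝ} (hr : 0 ≤ r) (Z : (ι × Bool) × Bool → E) :
    ∑ i, (∑ j ∈ closeSet r Z i, cloneCount r Z j ^ 2) ^ 2 ≤ ∑ i, cloneCount r Z i ^ 9 := by
  have hM1 : ∀ i, 1 ≤ cloneCount r Z i := one_le_cloneCount hr Z
  -- Cauchy–Schwarz gives `m ∑ M_j⁴`, and `m M_j⁴ ≤ (m² + M_j⁸) / 2` splits it so that only moments
  -- of a single count remain; `m³ ≤ M_i³ ≤ M_i⁹` absorbs the first part.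
  have hpt : ∀ i, (∑ j ∈ closeSet r Z i, cloneCount r Z j ^ 2) ^ 2
      ≤ (1 / 2) * (cloneCount r Z i ^ 9 + ∑ j ∈ closeSet r Z i, cloneCount r Z j ^ 8) := fun i => by
    set m : ℝ := ((closeSet r Z i).card : ℝ) with hm
    have hm0 : 0 ≤ m := Nat.cast_nonneg _
    have h1 : (∑ j ∈ closeSet r Z i, cloneCount r Z j ^ 2) ^ 2
        ≤ m * ∑ j ∈ closeSet r Z i, (cloneCount r Z j ^ 2) ^ 2 := sq_sum_le_card_mul_sum_sq
    have h2 : m * ∑ j ∈ closeSet r Z i, (cloneCount r Z j ^ 2) ^ 2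
        ≤ ∑ j ∈ closeSet r Z i, (1 / 2) * (m ^ 2 + cloneCount r Z j ^ 8) := by
      rw [Finset.mul_sum]
      refine Finset.sum_le_sum fun j _ => ?_
      nlinarith [sq_nonneg (m - cloneCount r Z j ^ 4)]
    rw [← Finset.mul_sum, Finset.sum_add_distrib, Finset.sum_const, nsmul_eq_mul, ← hm] at h2
    have h3 : m * m ^ 2 ≤ cloneCount r Z i ^ 9 := by
      calc m * m ^ 2 = m ^ 3 := by ring
        _ ≤ cloneCount r Z i ^ 3 := pow_le_pow_left₀ hm0 (card_closeSet_le r Z i) 3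
        _ ≤ cloneCount r Z i ^ 9 := pow_le_pow_right₀ (hM1 i) (by norm_num)
    linarith
  -- Closeness is symmetric, so `M_j⁸` is counted once for each index close to `j`, at most `M_j`
  -- times.
  have hswap : ∑ i, ∑ j ∈ closeSet r Z i, cloneCount r Z j ^ 8 ≤ ∑ i, cloneCount r Z i ^ 9 := by
    rw [Finset.sum_comm' (t' := Finset.univ) (s' := fun j => closeSet r Z j)
      (fun i j => by simp only [Finset.mem_univ, true_and, and_true]; exact mem_closeSet_comm)]
    refine Finset.sum_le_sum fun j _ => ?_
    rw [Finset.sum_const, nsmul_eq_mul, pow_succ (cloneCount r Z j) 8, mul_comm]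
    exact mul_le_mul_of_nonneg_left (card_closeSet_le r Z j)
      (pow_nonneg (zero_le_one.trans (hM1 j)) _)
  refine (Finset.sum_le_sum fun i _ => hpt i).trans ?_
  rw [← Finset.mul_sum, Finset.sum_add_distrib]
  linarith

end Count

/-! ### Local dependence of the exchange factor. -/

section LocalExchange

variable {E : Type*} [PseudoMetricSpace E] [DecidableEq E] {ψ : E → Finset E → ℝ} {ρ B : ℝ} {n : ℕ}

/-- `A` chooses between original and copy for the statistic, `s` for the outer Efron–Stein step. Any
such choice picks distinct members of the fourfold family, so its neighbour counts are dominated by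
`cloneCount`, uniformly in the choice. -/
lemma IsLocalFunctional.abs_vectorSum_sub_le_cloneCount (hloc : IsLocalFunctional ψ ρ)
    (hρ : 0 ≤ ρ) (hB : ∀ x 𝒳, |ψ x 𝒳| ≤ B) (Z : (Fin n × Bool) × Bool → E) (s : Fin n × Bool → Bool)
    (A A' : Fin n → Bool) (j : Fin n) (h : ∀ i, i ≠ j → A i = A' i) :
    |vectorSum ψ (fun i => Z ((i, A i), s (i, A i)))
        - vectorSum ψ (fun i => Z ((i, A' i), s (i, A' i)))| ≤ 4 * B * cloneCount (2 * ρ) Z j := by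
  have hB0 : 0 ≤ B := (abs_nonneg _).trans (hB (Z ((j, true), true)) ∅)
  have hcard : ∀ A : Fin n → Bool, ((Finset.univ.filter fun i =>
      dist (Z ((j, A j), s (j, A j))) (Z ((i, A i), s (i, A i))) ≤ ρ).card : ℝ)
        ≤ cloneCount (2 * ρ) Z j := fun A =>
    (card_filter_le_neighbourCount (r := 2 * ρ) (by linarith)
      (σ := fun i => ((i, A i), s (i, A i))) (fun i i' h => (Prod.ext_iff.mp
        (Prod.ext_iff.mp h).1).1) Z j).trans (neighbourCount_le_cloneCount _ Z j _ _)
  refine (hloc.abs_vectorSum_sub_le hρ hB (j := j) fun i hi => by rw [h i hi]).trans ?_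
  calc _ ≤ 2 * B * (cloneCount (2 * ρ) Z j + cloneCount (2 * ρ) Z j) :=
        mul_le_mul_of_nonneg_left (add_le_add (hcard A) (hcard A')) (by positivity)
    _ = _ := by ring

/-- If every copy of `j` is farther than `2ρ` from every copy of `i₀`, the choice made at `i₀`
cannot influence the cost of moving point `j`. -/
lemma IsLocalFunctional.vectorSum_sub_congr_of_notMem_closeSet (hloc : IsLocalFunctional ψ ρ)
    (hρ : 0 ≤ ρ) (Z : (Fin n × Bool) × Bool → E) {s s' : Fin n × Bool → Bool} {i₀ : Fin n}
    (hs : ∀ i c, i ≠ i₀ → s (i, c) = s' (i, c)) (A A' : Fin n → Bool) {j : Fin n}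
    (h : ∀ i, i ≠ j → A i = A' i) (hj : j ∉ closeSet (2 * ρ) Z i₀) :
    vectorSum ψ (fun i => Z ((i, A i), s (i, A i)))
        - vectorSum ψ (fun i => Z ((i, A' i), s (i, A' i)))
      = vectorSum ψ (fun i => Z ((i, A i), s' (i, A i)))
        - vectorSum ψ (fun i => Z ((i, A' i), s' (i, A' i))) := by
  have hfar : ∀ c e c' e', 2 * ρ < dist (Z ((j, c), e)) (Z ((i₀, c'), e')) := fun c e c' e' => by
    by_contra hcon
    exact hj (mem_closeSet.mpr ⟨c, e, c', e', not_lt.mp hcon⟩)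
  have hji : j ≠ i₀ := by
    rintro rfl
    have := hfar true true true true
    rw [dist_self] at this
    linarith
  refine hloc.vectorSum_sub_congr hρ (j := j) (fun i hi => by rw [h i hi])
    (fun i hi => by rw [h i hi]) (by rw [hs j _ hji]) (by rw [hs j _ hji]) fun i hi => ?_
  by_cases hii : i = i₀
  · subst hii
    exact Or.inr ⟨hfar _ _ _ _, hfar _ _ _ _, hfar _ _ _ _, hfar _ _ _ _⟩
  · exact Or.inl (by rw [hs i _ hii])

lemma lt_succ_select_congr (j : Fin n) (i : Fin n) (hi : i ≠ j) :
    decide ((i : ℕ) < j) = decide ((i : ℕ) < j + 1) := by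
  have : (i : ℕ) ≠ j := fun h => hi (Fin.ext h)
  congr 1
  apply propext
  omega

lemma single_select_congr {ι : Type*} [DecidableEq ι] (j : ι) (i : ι) (hi : i ≠ j) :
    false = decide (i = j) := by simp [hi]

/-- Changing one coordinate changes the exchange factor only through close coordinates. -/
lemma IsLocalFunctional.abs_singleDiff_exchangeFactor_le (hloc : IsLocalFunctional ψ ρ)
    (hρ : 0 ≤ ρ) (hB : ∀ x 𝒳, |ψ x 𝒳| ≤ B) (Z : (Fin n × Bool) × Bool → E) (i₀ : Fin n)
    (c₀ : Bool) :
    |singleDiff (exchangeFactor (vectorSum ψ)) (i₀, c₀) Z|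
      ≤ 16 * B ^ 2 * ∑ j ∈ closeSet (2 * ρ) Z i₀, cloneCount (2 * ρ) Z j ^ 2 := by
  -- `s` and `s'` describe the configuration before and after resampling the coordinate `(i₀, c₀)`.
  -- Terms with `j` outside `closeSet` cancel; each remaining one is at most `½ · 2 · (4 B M_j)²`.
  set s : Fin n × Bool → Bool := fun _ => false with hs
  set s' : Fin n × Bool → Bool := fun l => decide (l = (i₀, c₀)) with hs'
  have hss : ∀ i c, i ≠ i₀ → s (i, c) = s' (i, c) := fun i c hi => by
    simp [hs, hs', hi]
  have ha : ∀ (t : Fin n × Bool → Bool) j, |blockDiff (vectorSum ψ) j fun l => Z (l, t l)|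
      ≤ 4 * B * cloneCount (2 * ρ) Z j := fun t j =>
    hloc.abs_vectorSum_sub_le_cloneCount hρ hB Z t _ _ j (lt_succ_select_congr j)
  have hb : ∀ (t : Fin n × Bool → Bool) j, |singleDiff (vectorSum ψ) j fun l => Z (l, t l)|
      ≤ 4 * B * cloneCount (2 * ρ) Z j := fun t j =>
    hloc.abs_vectorSum_sub_le_cloneCount hρ hB Z t _ _ j (single_select_congr j)
  have hdiff : singleDiff (exchangeFactor (vectorSum ψ)) (i₀, c₀) Z
      = (1 / 2) * ∑ j, ((blockDiff (vectorSum ψ) j fun l => Z (l, s l))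
          * (singleDiff (vectorSum ψ) j fun l => Z (l, s l))
        - (blockDiff (vectorSum ψ) j fun l => Z (l, s' l))
          * (singleDiff (vectorSum ψ) j fun l => Z (l, s' l))) := by
    rw [Finset.sum_sub_distrib, mul_sub]
    rfl
  rw [hdiff, abs_mul, abs_of_pos (by norm_num : (0 : ℝ) < 1 / 2),
    ← Finset.sum_subset (Finset.subset_univ (closeSet (2 * ρ) Z i₀))]
  · calc _ ≤ (1 / 2) * ∑ j ∈ closeSet (2 * ρ) Z i₀, 32 * B ^ 2 * cloneCount (2 * ρ) Z j ^ 2 := by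
          refine mul_le_mul_of_nonneg_left ((Finset.abs_sum_le_sum_abs _ _).trans
            (Finset.sum_le_sum fun j _ => ?_)) (by norm_num)
          refine (abs_sub_le_two_mul (abs_mul_le_mul_of_le (ha s j) (hb s j))
            (abs_mul_le_mul_of_le (ha s' j) (hb s' j))).trans_eq ?_
          ring
      _ = _ := by
          rw [← Finset.mul_sum]
          ring
  · intro j _ hj
    have h1 : (blockDiff (vectorSum ψ) j fun l => Z (l, s l))
        = blockDiff (vectorSum ψ) j fun l => Z (l, s' l) :=
      hloc.vectorSum_sub_congr_of_notMem_closeSet hρ Z hss _ _ (lt_succ_select_congr j) hj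
    have h2 : (singleDiff (vectorSum ψ) j fun l => Z (l, s l))
        = singleDiff (vectorSum ψ) j fun l => Z (l, s' l) :=
      hloc.vectorSum_sub_congr_of_notMem_closeSet hρ Z hss _ _ (single_select_congr j) hj
    rw [h1, h2, sub_self]

/-- Sum of the squared changes of the exchange factor over all coordinates. -/
lemma IsLocalFunctional.sum_sq_singleDiff_exchangeFactor_le (hloc : IsLocalFunctional ψ ρ)
    (hρ : 0 ≤ ρ) (hB : ∀ x 𝒳, |ψ x 𝒳| ≤ B) (Z : (Fin n × Bool) × Bool → E) :
    ∑ k, singleDiff (exchangeFactor (vectorSum ψ)) k Z ^ 2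
      ≤ 512 * B ^ 4 * ∑ i, cloneCount (2 * ρ) Z i ^ 9 := by
  rw [Fintype.sum_prod_type]
  have hpt : ∀ i, ∑ c, singleDiff (exchangeFactor (vectorSum ψ)) (i, c) Z ^ 2
      ≤ 512 * B ^ 4 * (∑ j ∈ closeSet (2 * ρ) Z i, cloneCount (2 * ρ) Z j ^ 2) ^ 2 := fun i => by
    have h : ∀ c, singleDiff (exchangeFactor (vectorSum ψ)) (i, c) Z ^ 2
        ≤ 256 * B ^ 4 * (∑ j ∈ closeSet (2 * ρ) Z i, cloneCount (2 * ρ) Z j ^ 2) ^ 2 := fun c => by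
      rw [← sq_abs]
      refine (pow_le_pow_left₀ (abs_nonneg _)
        (hloc.abs_singleDiff_exchangeFactor_le hρ hB Z i c) 2).trans_eq ?_
      ring
    refine (Finset.sum_le_sum fun c _ => h c).trans_eq ?_
    simp only [Finset.sum_const, Finset.card_univ, Fintype.card_bool, nsmul_eq_mul]
    push_cast
    ring
  refine (Finset.sum_le_sum fun i _ => hpt i).trans ?_
  rw [← Finset.mul_sum]
  exact mul_le_mul_of_nonneg_left (sum_sq_sum_closeSet_le (by positivity) Z) (by positivity)

end LocalExchange

/-! ### Moments of neighbour counts. -/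

section Moments

variable {E : Type*} [MeasurableSpace E] (μ : Measure E) [IsProbabilityMeasure μ]
  {κ : Type*} [Fintype κ]

/-- Resampling one coordinate of an i.i.d. family. -/
lemma measurePreserving_update [DecidableEq κ] (k : κ) :
    MeasurePreserving (fun q : E × (κ → E) => Function.update q.2 k q.1)
      (μ.prod (Measure.pi fun _ => μ)) (Measure.pi fun _ => μ) := by
  have hm : Measurable fun q : E × (κ → E) => Function.update q.2 k q.1 := by
    refine measurable_pi_lambda _ fun l => ?_
    by_cases h : l = k
    · subst h
      simpa using measurable_fst
    · simp only [Function.update_of_ne h]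
      exact (measurable_pi_apply l).comp measurable_snd
  refine ⟨hm, (Measure.pi_eq fun s hs => ?_).symm⟩
  have hpre : (fun q : E × (κ → E) => Function.update q.2 k q.1) ⁻¹' Set.univ.pi s
      = s k ×ˢ Set.univ.pi (Function.update s k Set.univ) := by
    ext q
    simp only [Set.mem_preimage, Set.mem_univ_pi, Set.mem_prod]
    constructor
    · intro h
      refine ⟨by simpa using h k, fun l => ?_⟩
      by_cases hl : l = k
      · subst hl; simp
      · simpa [hl] using h l
    · rintro ⟨h1, h2⟩ l
      by_cases hl : l = k
      · subst hl; simpa using h1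
      · simpa [hl] using h2 l
  rw [Measure.map_apply hm (MeasurableSet.univ_pi hs), hpre, Measure.prod_prod, Measure.pi_pi,
    ← Finset.mul_prod_erase _ _ (Finset.mem_univ k),
    ← Finset.mul_prod_erase _ (fun i => μ (s i)) (Finset.mem_univ k)]
  rw [Function.update_self, measure_univ, one_mul]
  congr 1
  exact Finset.prod_congr rfl fun l hl => by
    rw [Function.update_of_ne (Finset.ne_of_mem_erase hl)]

variable [PseudoMetricSpace E] [SecondCountableTopology E] [OpensMeasurableSpace E]

omit [IsProbabilityMeasure μ] in
@[fun_prop]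
lemma measurable_neighbourCount (r : ℝ) (k : κ) :
    Measurable fun Y : κ → E => neighbourCount r Y k := by
  unfold neighbourCount
  refine Finset.measurable_fun_sum _ fun l _ => ?_
  exact Measurable.ite (measurableSet_le
    ((measurable_pi_apply k).dist (measurable_pi_apply l)) measurable_const)
    measurable_const measurable_const

omit [IsProbabilityMeasure μ] in
@[fun_prop]
lemma measurable_cloneCount {ι : Type*} [Fintype ι] (r : ℝ) (j : ι) :
    Measurable fun Z : (ι × Bool) × Bool → E => cloneCount r Z j := by
  unfold cloneCount
  fun_prop

/-- Given the position `x` of point `k`, the other indicators are independent with success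
probability at most `p`. Each contributes at most `1 + p (e^(1/v) - 1) ≤ e^(2p/v)`, together at most
`e²`; point `k` itself contributes at most `e`. -/
lemma integral_exp_neighbourCount_le {r p v : ℝ} (hp : ∀ x, μ.real (Metric.closedBall x r) ≤ p)
    (hv : 1 ≤ v) (hpv : Fintype.card κ * p ≤ v) (k : κ) :
    ∫ Y : κ → E, Real.exp (neighbourCount r Y k / v) ∂(Measure.pi fun _ => μ) ≤ Real.exp 3 := by
  classical
  have hv0 : 0 < v := zero_lt_one.trans_le hv
  have hinv : 1 / v ≤ 1 := by rw [div_le_one hv0]; exact hv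
  set g : E → E → ℝ := fun x y => Real.exp ((if dist x y ≤ r then 1 else 0) / v) with hg
  have hgm : Measurable fun q : E × E => g q.1 q.2 := by
    refine Real.measurable_exp.comp (Measurable.div_const (Measurable.ite (measurableSet_le
      (measurable_fst.dist measurable_snd) measurable_const)
      measurable_const measurable_const) _)
  have hexpm : Measurable fun Y : κ → E => Real.exp (neighbourCount r Y k / v) := by fun_prop
  have hmp := measurePreserving_update μ k
  have hgb : ∀ x y, |g x y| ≤ Real.exp 1 := fun x y => by
    simp only [hg, Real.abs_exp]
    refine Real.exp_le_exp.mpr ?_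
    split_ifs
    · exact hinv
    · simp
  have hgi : ∀ x, ∫ y, g x y ∂μ ≤ Real.exp (2 * p / v) := fun x => by
    have hgx : ∀ y, g x y = 1 + (Metric.closedBall x r).indicator
        (fun _ => Real.exp (1 / v) - 1) y := fun y => by
      simp only [hg, Set.indicator, Metric.mem_closedBall, dist_comm y x]
      split_ifs <;> simp
    simp_rw [hgx]
    rw [integral_add (integrable_const _) ((integrable_const _).indicator
      Metric.isClosed_closedBall.measurableSet),
      integral_indicator Metric.isClosed_closedBall.measurableSet, setIntegral_const,
      integral_const, probReal_univ, one_smul, smul_eq_mul]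
    have h1 := Real.abs_exp_sub_one_le (x := 1 / v) (by rwa [abs_of_pos (by positivity)])
    rw [abs_of_pos (by positivity : 0 < 1 / v)] at h1
    have h2 := (le_abs_self _).trans h1
    have h3 : 0 ≤ Real.exp (1 / v) - 1 := by
      have := Real.add_one_le_exp (1 / v)
      have : 0 < 1 / v := by positivity
      linarith
    have h4 : μ.real (Metric.closedBall x r) * (Real.exp (1 / v) - 1) ≤ p * (2 * (1 / v)) :=
      mul_le_mul (hp x) h2 h3 (measureReal_nonneg.trans (hp x))
    have h5 := Real.add_one_le_exp (2 * p / v)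
    have h6 : p * (2 * (1 / v)) = 2 * p / v := by ring
    linarith
  -- The product runs over all `l`, including the discarded coordinate `k`, whose factor is at least
  -- one. This leaves a full product over an i.i.d. family.
  have hbound : ∀ (x : E) (y : κ → E),
      Real.exp (neighbourCount r (Function.update y k x) k / v)
        ≤ Real.exp 1 * ∏ l, g x (y l) := fun x y => by
    rw [← Real.exp_sum, ← Real.exp_add, ← Finset.sum_div]
    refine Real.exp_le_exp.mpr ?_
    have h1 : neighbourCount r (Function.update y k x) k
        ≤ 1 + ∑ l, if dist x (y l) ≤ r then (1 : ℝ) else 0 := by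
      unfold neighbourCount
      rw [← Finset.add_sum_erase _ _ (Finset.mem_univ k),
        ← Finset.add_sum_erase _ (fun l => if dist x (y l) ≤ r then (1 : ℝ) else 0)
          (Finset.mem_univ k)]
      refine add_le_add (by split_ifs <;> norm_num) ?_
      refine le_add_of_nonneg_of_le (by split_ifs <;> norm_num) (Finset.sum_le_sum fun l hl => ?_)
      rw [Function.update_self, Function.update_of_ne (Finset.ne_of_mem_erase hl)]
    calc _ ≤ (1 + ∑ l, if dist x (y l) ≤ r then (1 : ℝ) else 0) / v :=
          div_le_div_of_nonneg_right h1 hv0.le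
      _ ≤ _ := by
          rw [add_div]
          linarith
  have hprodm : Measurable fun q : E × (κ → E) => Real.exp 1 * ∏ l, g q.1 (q.2 l) := by
    refine measurable_const.mul (Finset.measurable_fun_prod _ fun l _ => ?_)
    exact hgm.comp (measurable_fst.prodMk ((measurable_pi_apply l).comp measurable_snd))
  have hprodb : ∀ q : E × (κ → E), |Real.exp 1 * ∏ l, g q.1 (q.2 l)|
      ≤ Real.exp 1 * Real.exp 1 ^ Fintype.card κ := fun q => by
    rw [abs_mul, Real.abs_exp, Finset.abs_prod]
    refine mul_le_mul_of_nonneg_left ?_ (Real.exp_pos _).le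
    refine (Finset.prod_le_prod (fun _ _ => abs_nonneg _) fun l _ => hgb _ _).trans_eq ?_
    simp
  have hprodi : Integrable (fun q : E × (κ → E) => Real.exp 1 * ∏ l, g q.1 (q.2 l))
      (μ.prod (Measure.pi fun _ => μ)) := integrable_of_measurable_of_abs_le hprodm hprodb
  rw [← hmp.map_eq, integral_map hmp.measurable.aemeasurable hexpm.aestronglyMeasurable]
  calc _ ≤ ∫ q, Real.exp 1 * ∏ l, g q.1 (q.2 l) ∂(μ.prod (Measure.pi fun _ : κ => μ)) := by
        refine integral_mono (hprodi.mono' (hexpm.comp hmp.measurable).aestronglyMeasurable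
          (Filter.Eventually.of_forall fun q => ?_)) hprodi fun q => hbound q.1 q.2
        rw [Real.norm_eq_abs, Real.abs_exp]
        exact hbound q.1 q.2
    _ = ∫ x, ∫ y : κ → E, Real.exp 1 * ∏ l, g x (y l) ∂(Measure.pi fun _ => μ) ∂μ :=
        integral_prod _ hprodi
    _ ≤ ∫ _x, Real.exp 3 ∂μ := by
        refine integral_mono hprodi.integral_prod_left (integrable_const _) fun x => ?_
        simp only
        rw [integral_const_mul, integral_fintype_prod_eq_prod (f := fun _ => g x),
          Finset.prod_const, Finset.card_univ]
        have h1 : (∫ y, g x y ∂μ) ^ Fintype.card κ ≤ Real.exp 2 := by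
          refine (pow_le_pow_left₀ (integral_nonneg fun y => (Real.exp_pos _).le) (hgi x) _).trans ?_
          rw [← Real.exp_nat_mul]
          refine Real.exp_le_exp.mpr ?_
          rw [← mul_div_assoc, div_le_iff₀ hv0]
          linarith
        calc _ ≤ Real.exp 1 * Real.exp 2 := mul_le_mul_of_nonneg_left h1 (Real.exp_pos _).le
          _ = Real.exp 3 := by rw [← Real.exp_add]; norm_num
    _ = Real.exp 3 := by simp

/-- From the exponential moment by `t^q / q! ≤ e^t` at `t = count / v`. -/
lemma integral_neighbourCount_pow_le {r p v : ℝ} (hp : ∀ x, μ.real (Metric.closedBall x r) ≤ p)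
    (hv : 1 ≤ v) (hpv : Fintype.card κ * p ≤ v) (k : κ) (q : ℕ) :
    ∫ Y : κ → E, neighbourCount r Y k ^ q ∂(Measure.pi fun _ => μ)
      ≤ q.factorial * Real.exp 3 * v ^ q := by
  have hv0 : 0 < v := zero_lt_one.trans_le hv
  have hpt : ∀ Y : κ → E, neighbourCount r Y k ^ q
      ≤ q.factorial * v ^ q * Real.exp (neighbourCount r Y k / v) := fun Y => by
    have h := Real.pow_div_factorial_le_exp (neighbourCount r Y k / v)
      (div_nonneg (neighbourCount_nonneg r Y k) hv0.le) q
    rw [div_le_iff₀ (by positivity), div_pow, div_le_iff₀ (by positivity)] at h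
    linarith
  have hi1 : Integrable (fun Y : κ → E => neighbourCount r Y k ^ q) (Measure.pi fun _ => μ) :=
    integrable_of_measurable_of_abs_le (C := (Fintype.card κ : ℝ) ^ q) (by fun_prop) fun Y => by
      rw [abs_pow, abs_of_nonneg (neighbourCount_nonneg r Y k)]
      exact pow_le_pow_left₀ (neighbourCount_nonneg r Y k) (neighbourCount_le_card r Y k) q
  have hi2 : Integrable (fun Y : κ → E => Real.exp (neighbourCount r Y k / v))
      (Measure.pi fun _ => μ) :=
    integrable_of_measurable_of_abs_le (C := Real.exp (Fintype.card κ / v)) (by fun_prop)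
      fun Y => by
        rw [Real.abs_exp]
        exact Real.exp_le_exp.mpr (div_le_div_of_nonneg_right (neighbourCount_le_card r Y k) hv0.le)
  refine (integral_mono hi1 (hi2.const_mul _) hpt).trans ?_
  rw [integral_const_mul]
  have := mul_le_mul_of_nonneg_left (integral_exp_neighbourCount_le μ hp hv hpv k)
    (show 0 ≤ (q.factorial : ℝ) * v ^ q by positivity)
  linarith

variable {ι : Type*} [Fintype ι]

/-- The constant in the moment bound for the number of neighbours. -/
noncomputable def momentConst (q : ℕ) : ℝ := 4 ^ q * q.factorial * Real.exp 3

lemma integrable_cloneCount_pow (r : ℝ) (j : ι) (q : ℕ) :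
    Integrable (fun Z : (ι × Bool) × Bool → E => cloneCount r Z j ^ q) (Measure.pi fun _ => μ) := by
  have h0 : ∀ Z : (ι × Bool) × Bool → E, 0 ≤ cloneCount r Z j := fun Z =>
    Finset.sum_nonneg fun _ _ => Finset.sum_nonneg fun _ _ => neighbourCount_nonneg _ _ _
  refine integrable_of_measurable_of_abs_le (C := (∑ _c : Bool, ∑ _e : Bool,
    (Fintype.card ((ι × Bool) × Bool) : ℝ)) ^ q) (by fun_prop) fun Z => ?_
  rw [abs_pow, abs_of_nonneg (h0 Z)]
  exact pow_le_pow_left₀ (h0 Z) (Finset.sum_le_sum fun _ _ => Finset.sum_le_sum fun _ _ =>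
    neighbourCount_le_card _ _ _) q

/-- The power mean inequality over the four copies reduces to a single neighbour count; this is the
source of `4 ^ q` in `momentConst`. -/
lemma integral_cloneCount_pow_le {r p v : ℝ} (hp : ∀ x, μ.real (Metric.closedBall x r) ≤ p)
    (hv : 1 ≤ v) (hpv : Fintype.card ((ι × Bool) × Bool) * p ≤ v) (j : ι) (q : ℕ) :
    ∫ Z : (ι × Bool) × Bool → E, cloneCount r Z j ^ (q + 1) ∂(Measure.pi fun _ => μ)
      ≤ momentConst (q + 1) * v ^ (q + 1) := by
  have hpt : ∀ Z : (ι × Bool) × Bool → E, cloneCount r Z j ^ (q + 1)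
      ≤ 4 ^ q * ∑ s : Bool × Bool, neighbourCount r Z ((j, s.1), s.2) ^ (q + 1) := fun Z => by
    have h := pow_sum_div_card_le_sum_pow (s := Finset.univ)
      (f := fun s : Bool × Bool => neighbourCount r Z ((j, s.1), s.2))
      (fun s _ => neighbourCount_nonneg _ _ _) q
    rw [div_le_iff₀ (by simp)] at h
    have hc : cloneCount r Z j = ∑ s : Bool × Bool, neighbourCount r Z ((j, s.1), s.2) := by
      rw [Fintype.sum_prod_type]
      rfl
    rw [hc, mul_comm]
    refine h.trans_eq ?_
    simp
  have hi : ∀ s : Bool × Bool, Integrable (fun Z : (ι × Bool) × Bool → E =>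
      neighbourCount r Z ((j, s.1), s.2) ^ (q + 1)) (Measure.pi fun _ => μ) := fun s =>
    integrable_of_measurable_of_abs_le (C := (Fintype.card ((ι × Bool) × Bool) : ℝ) ^ (q + 1))
      (by fun_prop) fun Z => by
        rw [abs_pow, abs_of_nonneg (neighbourCount_nonneg _ _ _)]
        exact pow_le_pow_left₀ (neighbourCount_nonneg _ _ _) (neighbourCount_le_card _ _ _) _
  refine (integral_mono (integrable_cloneCount_pow μ r j (q + 1))
    ((integrable_finsetSum _ fun s _ => hi s).const_mul _) hpt).trans ?_
  rw [integral_const_mul, integral_finsetSum _ fun s _ => hi s]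
  have h1 : ∑ s : Bool × Bool, ∫ Z : (ι × Bool) × Bool → E,
      neighbourCount r Z ((j, s.1), s.2) ^ (q + 1) ∂(Measure.pi fun _ => μ)
      ≤ ∑ _s : Bool × Bool, ((q + 1).factorial * Real.exp 3 * v ^ (q + 1)) :=
    Finset.sum_le_sum fun s _ => integral_neighbourCount_pow_le μ hp hv hpv _ _
  refine (mul_le_mul_of_nonneg_left h1 (by positivity)).trans_eq ?_
  simp only [Finset.sum_const, Finset.card_univ, Fintype.card_prod, Fintype.card_bool, nsmul_eq_mul,
    momentConst]
  push_cast
  ring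

end Moments

/-! ### Normal approximation for local functionals. -/

section LocalBound

variable {E : Type*} [PseudoMetricSpace E] [DecidableEq E] [MeasurableSpace E]
  [SecondCountableTopology E] [OpensMeasurableSpace E] (μ : Measure E) [IsProbabilityMeasure μ]
  {ψ : E → Finset E → ℝ} {ρ B : ℝ} {n : ℕ}

/-- The constant in the normal approximation bound for local functionals. -/
noncomputable def localConst : ℝ :=
  8 * √(2048 * momentConst 9 * momentConst 2) + 768 * momentConst 3

lemma momentConst_pos (q : ℕ) : 0 < momentConst q := by
  unfold momentConst
  positivity

lemma localConst_pos : 0 < localConst := by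
  unfold localConst
  have := momentConst_pos 3
  positivity

omit [PseudoMetricSpace E] [MeasurableSpace E] [SecondCountableTopology E]
  [OpensMeasurableSpace E] in
lemma abs_vectorSum_le (hB : ∀ x 𝒳, |ψ x 𝒳| ≤ B) (y : Fin n → E) :
    |vectorSum ψ y| ≤ n * |B| := by
  unfold vectorSum totalSum
  refine (Finset.abs_sum_le_sum_abs _ _).trans
    ((Finset.sum_le_sum fun x _ => (hB x _).trans (le_abs_self B)).trans ?_)
  rw [Finset.sum_const, nsmul_eq_mul]
  refine mul_le_mul_of_nonneg_right ?_ (abs_nonneg B)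
  exact_mod_cast Finset.card_image_le.trans_eq (by simp)

/-- The doubled family is embedded in the fourfold one, so that the moment bounds for `cloneCount`
serve here too. -/
lemma IsLocalFunctional.sum_integral_abs_singleDiff_pow_le (hloc : IsLocalFunctional ψ ρ)
    (hρ : 0 ≤ ρ) (hB : ∀ x 𝒳, |ψ x 𝒳| ≤ B)
    (hm : Measurable (vectorSum ψ : (Fin n → E) → ℝ)) {p v : ℝ}
    (hp : ∀ x, μ.real (Metric.closedBall x (2 * ρ)) ≤ p) (hv : 1 ≤ v) (hpv : 4 * n * p ≤ v)
    (q : ℕ) :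
    ∑ j, ∫ Y : Fin n × Bool → E, |singleDiff (vectorSum ψ) j Y| ^ (q + 1) ∂(Measure.pi fun _ => μ)
      ≤ n * ((4 * B) ^ (q + 1) * (momentConst (q + 1) * v ^ (q + 1))) := by
  have h : ∀ j, ∫ Y : Fin n × Bool → E, |singleDiff (vectorSum ψ) j Y| ^ (q + 1)
      ∂(Measure.pi fun _ => μ) ≤ (4 * B) ^ (q + 1) * (momentConst (q + 1) * v ^ (q + 1)) :=
    fun j => by
    have hB0 : 0 ≤ 4 * B := by
      by_cases hE : Nonempty E
      · obtain ⟨x⟩ := hE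
        have := (abs_nonneg _).trans (hB x ∅)
        linarith
      · exact absurd ⟨(nonempty_of_isProbabilityMeasure μ).some⟩ hE
    have hmeas : Measurable fun Y : Fin n × Bool → E =>
        |singleDiff (vectorSum ψ) j Y| ^ (q + 1) := by fun_prop
    have hinj : Function.Injective fun l : Fin n × Bool => (l, false) := fun l l' h =>
      (Prod.ext_iff.mp h).1
    rw [← integral_comp_injective μ hinj hmeas]
    have hpt : ∀ Z : (Fin n × Bool) × Bool → E,
        |singleDiff (vectorSum ψ) j fun l => Z (l, false)|
          ≤ 4 * B * cloneCount (2 * ρ) Z j := fun Z =>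
      hloc.abs_vectorSum_sub_le_cloneCount hρ hB Z (fun _ => false) _ _ j (single_select_congr j)
    calc _ ≤ ∫ Z : (Fin n × Bool) × Bool → E, (4 * B) ^ (q + 1) * cloneCount (2 * ρ) Z j ^ (q + 1)
          ∂(Measure.pi fun _ => μ) := by
          refine integral_mono (integrable_of_measurable_of_abs_le
            (C := (2 * (n * |B|)) ^ (q + 1)) (hmeas.comp (by fun_prop)) fun Z => ?_)
            ((integrable_cloneCount_pow μ _ _ _).const_mul _) fun Z => ?_
          · rw [abs_pow, abs_abs]
            exact pow_le_pow_left₀ (abs_nonneg _) (abs_singleDiff_le (abs_vectorSum_le hB) j _) _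
          · simp only
            rw [← mul_pow]
            exact pow_le_pow_left₀ (abs_nonneg _) (hpt Z) _
      _ ≤ _ := by
          rw [integral_const_mul]
          refine mul_le_mul_of_nonneg_left (integral_cloneCount_pow_le μ hp hv ?_ j q)
            (pow_nonneg hB0 _)
          simp only [Fintype.card_prod, Fintype.card_fin, Fintype.card_bool]
          push_cast
          linarith
  refine (Finset.sum_le_sum fun j _ => h j).trans_eq ?_
  simp

/-- Efron–Stein applied to the exchange factor as a function of `2n` independent coordinates,
followed by the pointwise bound and ninth moments; `256 = ½ · 512`. -/
lemma IsLocalFunctional.variance_exchangeFactor_le (hloc : IsLocalFunctional ψ ρ)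
    (hρ : 0 ≤ ρ) (hB : ∀ x 𝒳, |ψ x 𝒳| ≤ B)
    (hm : Measurable (vectorSum ψ : (Fin n → E) → ℝ)) {p v : ℝ}
    (hp : ∀ x, μ.real (Metric.closedBall x (2 * ρ)) ≤ p) (hv : 1 ≤ v) (hpv : 4 * n * p ≤ v) :
    ∫ Y : Fin n × Bool → E, exchangeFactor (vectorSum ψ) Y ^ 2 ∂(Measure.pi fun _ => μ)
        - (∫ Y : Fin n × Bool → E, exchangeFactor (vectorSum ψ) Y ∂(Measure.pi fun _ => μ)) ^ 2
      ≤ 256 * B ^ 4 * (n * (momentConst 9 * v ^ 9)) := by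
  have hTm := measurable_exchangeFactor hm
  have hTb := abs_exchangeFactor_le (abs_vectorSum_le (n := n) hB)
  refine (efronStein μ hTm hTb).trans ?_
  have hi : ∀ k : Fin n × Bool, Integrable (fun Z : (Fin n × Bool) × Bool → E =>
      singleDiff (exchangeFactor (vectorSum ψ)) k Z ^ 2) (Measure.pi fun _ => μ) := fun k => by
    refine integrable_of_measurable_of_abs_le
      (C := (2 * ((1 / 2) * ∑ _j : Fin n, 2 * (n * |B|) * (2 * (n * |B|)))) ^ 2)
      ((measurable_singleDiff hTm k).pow_const 2) fun Z => ?_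
    rw [abs_pow]
    exact pow_le_pow_left₀ (abs_nonneg _) (abs_singleDiff_le hTb k Z) 2
  rw [← integral_finsetSum _ fun k _ => hi k]
  have h1 : ∫ Z : (Fin n × Bool) × Bool → E,
      ∑ k, singleDiff (exchangeFactor (vectorSum ψ)) k Z ^ 2 ∂(Measure.pi fun _ => μ)
      ≤ ∫ Z : (Fin n × Bool) × Bool → E, 512 * B ^ 4 * ∑ i, cloneCount (2 * ρ) Z i ^ 9
        ∂(Measure.pi fun _ => μ) :=
    integral_mono (integrable_finsetSum _ fun k _ => hi k)
      ((integrable_finsetSum _ fun i _ => integrable_cloneCount_pow μ _ i 9).const_mul _)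
      fun Z => hloc.sum_sq_singleDiff_exchangeFactor_le hρ hB Z
  rw [integral_const_mul, integral_finsetSum _ fun i _ => integrable_cloneCount_pow μ _ i 9] at h1
  have h2 : ∑ i : Fin n, ∫ Z : (Fin n × Bool) × Bool → E, cloneCount (2 * ρ) Z i ^ 9
      ∂(Measure.pi fun _ => μ) ≤ n * (momentConst 9 * v ^ 9) := by
    refine (Finset.sum_le_sum fun i _ => integral_cloneCount_pow_le μ hp hv ?_ i 8).trans_eq ?_
    · simp only [Fintype.card_prod, Fintype.card_fin, Fintype.card_bool]
      push_cast
      linarith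
    · simp
  have h3 := mul_le_mul_of_nonneg_left h2 (show 0 ≤ 512 * B ^ 4 by positivity)
  linarith

/-- Normal approximation for sums of local functionals of i.i.d. points. -/
theorem IsLocalFunctional.wassersteinDist_le (hloc : IsLocalFunctional ψ ρ) (hρ : 0 ≤ ρ)
    (hB : ∀ x 𝒳, |ψ x 𝒳| ≤ B) (hm : Measurable (vectorSum ψ : (Fin n → E) → ℝ)) {p v : ℝ}
    (hp : ∀ x, μ.real (Metric.closedBall x (2 * ρ)) ≤ p) (hv : 1 ≤ v) (hpv : 4 * n * p ≤ v)
    (h0 : ∫ y : Fin n → E, vectorSum ψ y ∂(Measure.pi fun _ => μ) = 0)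
    (h1 : ∫ y : Fin n → E, vectorSum ψ y ^ 2 ∂(Measure.pi fun _ => μ) = 1) :
    wassersteinDist ((Measure.pi fun _ : Fin n => μ).map (vectorSum ψ)) (gaussianReal 0 1)
      ≤ ENNReal.ofReal (localConst * (B ^ 3 * v ^ 6 * n)) := by
  have hCb := abs_vectorSum_le (n := n) hB
  refine (wassersteinDist_map_le μ hm hCb h0 h1).trans (ENNReal.ofReal_le_ofReal ?_)
  have hB0 : 0 ≤ B := (abs_nonneg _).trans (hB (nonempty_of_isProbabilityMeasure μ).some ∅)
  have hv0 : 0 < v := zero_lt_one.trans_le hv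
  have hn0 : (0 : ℝ) ≤ n := Nat.cast_nonneg n
  have c9 := momentConst_pos 9
  have c2 := momentConst_pos 2
  have c3 := momentConst_pos 3
  have hvar := hloc.variance_exchangeFactor_le μ hρ hB hm hp hv hpv
  have h3 := hloc.sum_integral_abs_singleDiff_pow_le μ hρ hB hm hp hv hpv 2
  have h2 := hloc.sum_integral_abs_singleDiff_pow_le μ hρ hB hm hp hv hpv 1
  have hes := efronStein μ hm hCb
  rw [h0, h1] at hes
  simp only [← sq_abs (singleDiff _ _ _)] at hes
  norm_num at h2 h3 hes
  -- Efron–Stein for the statistic itself, whose variance is one. It supplies the missing factor `B²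
  -- n` under the root below, giving `v¹¹`, rounded up to `v¹²` by `v ≥ 1`.
  have hone : 1 ≤ 8 * B ^ 2 * (n * (momentConst 2 * v ^ 2)) := by linarith
  have hsqrt : √(256 * B ^ 4 * (n * (momentConst 9 * v ^ 9)))
      ≤ √(2048 * momentConst 9 * momentConst 2) * (B ^ 3 * v ^ 6 * n) := by
    refine Real.sqrt_le_iff.mpr ⟨by positivity, ?_⟩
    rw [mul_pow, Real.sq_sqrt (by positivity)]
    calc 256 * B ^ 4 * (n * (momentConst 9 * v ^ 9))
        ≤ 256 * B ^ 4 * (n * (momentConst 9 * v ^ 9)) * (8 * B ^ 2 * (n * (momentConst 2 * v ^ 2))) :=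
          le_mul_of_one_le_right (by positivity) hone
      _ = 2048 * momentConst 9 * momentConst 2 * (B ^ 6 * n ^ 2) * v ^ 11 := by ring
      _ ≤ 2048 * momentConst 9 * momentConst 2 * (B ^ 6 * n ^ 2) * v ^ 12 :=
          mul_le_mul_of_nonneg_left (pow_le_pow_right₀ hv (by norm_num)) (by positivity)
      _ = 2048 * momentConst 9 * momentConst 2 * (B ^ 3 * v ^ 6 * n) ^ 2 := by ring
  have hcube : n * ((4 * B) ^ 3 * (momentConst 3 * v ^ 3))
      ≤ 64 * momentConst 3 * (B ^ 3 * v ^ 6 * n) := by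
    calc n * ((4 * B) ^ 3 * (momentConst 3 * v ^ 3))
        = 64 * momentConst 3 * B ^ 3 * n * v ^ 3 := by ring
      _ ≤ 64 * momentConst 3 * B ^ 3 * n * v ^ 6 :=
          mul_le_mul_of_nonneg_left (pow_le_pow_right₀ hv (by norm_num)) (by positivity)
      _ = _ := by ring
  have hs := (Real.sqrt_le_sqrt hvar).trans hsqrt
  have hfin : localConst * (B ^ 3 * v ^ 6 * n)
      = 8 * (√(2048 * momentConst 9 * momentConst 2) * (B ^ 3 * v ^ 6 * n))
        + 12 * (64 * momentConst 3 * (B ^ 3 * v ^ 6 * n)) := by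
    unfold localConst
    ring
  rw [hfin]
  linarith

end LocalBound

/-! ### Geometry of the torus and its uniform law. -/

section Torus

variable {d n : ℕ}

lemma torusSide_pow (hd : 1 ≤ d) : torusSide d n ^ d = n := by
  unfold torusSide
  rw [← Real.rpow_natCast, ← Real.rpow_mul (Nat.cast_nonneg n)]
  have : (d : ℝ) ≠ 0 := by positivity
  rw [one_div_mul_cancel this, Real.rpow_one]

lemma dist_le_torusDist (x y : Torus d n) : dist x y ≤ torusDist x y := by
  refine (dist_pi_le_iff (Real.sqrt_nonneg _)).mpr fun i => ?_
  rw [dist_eq_norm]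
  refine Real.le_sqrt_of_sq_le ?_
  exact Finset.single_le_sum (f := fun i => ‖x i - y i‖ ^ 2) (fun _ _ => sq_nonneg _)
    (Finset.mem_univ i)

/-- The metric of the product type is the sup metric. Its balls contain the Euclidean balls of the
same radius, so locality carries over with the same `ρ`. -/
lemma HasInfluenceRadius.isLocalFunctional {ψ : Torus d n → Finset (Torus d n) → ℝ} {ρ : ℝ}
    (h : HasInfluenceRadius ψ ρ) : IsLocalFunctional ψ ρ := by
  classical
  intro x 𝒳 𝒴 hxy
  rw [h x 𝒳, h x 𝒴]
  congr 1
  ext y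
  simp only [Finset.mem_filter]
  exact and_congr_left fun hy => hxy y ((dist_le_torusDist x y).trans hy)

variable [NeZero n]

instance : NullSingletonClass (volume : Measure (AddCircle (torusSide d n))) := by
  refine ⟨fun x => ?_⟩
  have h := AddCircle.volume_closedBall (T := torusSide d n) (x := x) 0
  have hT : 0 < torusSide d n := Fact.out
  simpa [hT.le] using h

/-- The uniform distribution on the torus. -/
noncomputable def torusUniform (d n : ℕ) [NeZero n] : Measure (Torus d n) :=
  (volume : Measure (Torus d n))[|Set.univ]

lemma volume_torus_univ (hd : 1 ≤ d) : (volume : Measure (Torus d n)) Set.univ = n := by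
  rw [volume_pi, Measure.pi_univ]
  simp only [AddCircle.measure_univ, Finset.prod_const, Finset.card_univ, Fintype.card_fin]
  have hT : 0 < torusSide d n := Fact.out
  rw [← ENNReal.ofReal_pow hT.le, torusSide_pow hd, ENNReal.ofReal_natCast]

lemma torusUniform_apply (hd : 1 ≤ d) (s : Set (Torus d n)) :
    torusUniform d n s = (n : ℝ≥0∞)⁻¹ * volume s := by
  unfold torusUniform
  rw [cond_apply MeasurableSet.univ, volume_torus_univ hd, Set.univ_inter]

lemma isProbabilityMeasure_torusUniform (hd : 1 ≤ d) : IsProbabilityMeasure (torusUniform d n) := by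
  refine ⟨?_⟩
  rw [torusUniform_apply hd, volume_torus_univ hd]
  exact ENNReal.inv_mul_cancel (by exact_mod_cast NeZero.ne n) (by simp)

lemma torusUniform_singleton (hd : 1 ≤ d) (x : Torus d n) : torusUniform d n {x} = 0 := by
  rw [torusUniform_apply hd, volume_pi, Measure.pi_singleton,
    Finset.prod_eq_zero (Finset.mem_univ (⟨0, hd⟩ : Fin d)) (measure_singleton _), mul_zero]

/-- A sup-metric ball is a product of arcs, each of length at most `2r` even when it wraps around
the circle. -/
lemma torusUniform_closedBall_le (hd : 1 ≤ d) {r : ℝ} (hr : 0 ≤ r) (x : Torus d n) :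
    (torusUniform d n).real (Metric.closedBall x r) ≤ (2 * r) ^ d / n := by
  have hn : (0 : ℝ) < n := Nat.cast_pos.mpr (Nat.pos_of_ne_zero (NeZero.ne n))
  refine ENNReal.toReal_le_of_le_ofReal (by positivity) ?_
  rw [torusUniform_apply hd, volume_pi, Measure.pi_closedBall _ _ hr, div_eq_inv_mul,
    ENNReal.ofReal_mul (by positivity), ENNReal.ofReal_inv_of_pos hn, ENNReal.ofReal_natCast]
  refine mul_le_mul_right ?_ _
  rw [ENNReal.ofReal_pow (by positivity)]
  calc _ ≤ ∏ _i : Fin d, ENNReal.ofReal (2 * r) := by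
        refine Finset.prod_le_prod' fun i _ => ?_
        rw [AddCircle.volume_closedBall]
        exact ENNReal.ofReal_le_ofReal (min_le_right _ _)
    _ = _ := by simp

end Torus

/-! ### Sums over the point set versus sums over indices. -/

section Sums

variable {E : Type*} [DecidableEq E] {ψ : E → Finset E → ℝ} {n : ℕ}

/-- Dividing by multiplicity makes the sum over distinct values a sum over indices for every vector,
with repetitions allowed. Measurability can then be checked term by term. -/
lemma vectorSum_eq_sum_div_card (y : Fin n → E) :
    vectorSum ψ y = ∑ i, ψ (y i) (Finset.univ.image y)
      / (Finset.univ.filter fun j => y j = y i).card := by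
  have h := Finset.sum_comp (s := Finset.univ) (fun x => ψ x (Finset.univ.image y)
    / ((Finset.univ.filter fun j => y j = x).card : ℝ)) y
  rw [h]
  change ∑ x ∈ Finset.univ.image y, ψ x (Finset.univ.image y) = _
  refine Finset.sum_congr rfl fun x hx => ?_
  obtain ⟨i, _, rfl⟩ := Finset.mem_image.mp hx
  have hne : ((Finset.univ.filter fun j => y j = y i).card : ℝ) ≠ 0 := by
    have : 0 < (Finset.univ.filter fun j => y j = y i).card :=
      Finset.card_pos.mpr ⟨i, by simp⟩
    positivity
  rw [nsmul_eq_mul, mul_div_cancel₀ _ hne]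

lemma measurable_vectorSum [MeasurableSpace E] [MeasurableEq E]
    (hψ : Measurable fun p : E × (Fin n → E) => ψ p.1 (Finset.univ.image p.2)) :
    Measurable (vectorSum ψ : (Fin n → E) → ℝ) := by
  have : (vectorSum ψ : (Fin n → E) → ℝ) = fun y => ∑ i, ψ (y i) (Finset.univ.image y)
      / ∑ j, if y j = y i then (1 : ℝ) else 0 := by
    funext y
    rw [vectorSum_eq_sum_div_card]
    simp only [Finset.sum_boole]
  rw [this]
  refine Finset.measurable_fun_sum _ fun i _ => Measurable.div ?_ ?_
  · exact hψ.comp (f := fun y : Fin n → E => (y i, y)) (by fun_prop)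
  · refine Finset.measurable_fun_sum _ fun j _ => Measurable.ite ?_ measurable_const
      measurable_const
    exact measurableSet_eq_fun (measurable_pi_apply j) (measurable_pi_apply i)

-- Resample coordinate `i`: for each fixed value `x`, the event `y j = x` is null because the law
-- has no atoms.
omit [DecidableEq E] in
lemma ae_injective [MeasurableSpace E] [MeasurableEq E] (μ : Measure E) [IsProbabilityMeasure μ]
    (hμ : ∀ x, μ {x} = 0) :
    ∀ᵐ y : Fin n → E ∂(Measure.pi fun _ => μ), Function.Injective y := by
  have h : ∀ i j : Fin n, i ≠ j → ∀ᵐ y : Fin n → E ∂(Measure.pi fun _ => μ), y i ≠ y j := by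
    intro i j hij
    have hs : MeasurableSet {y : Fin n → E | y i = y j} :=
      measurableSet_eq_fun (measurable_pi_apply i) (measurable_pi_apply j)
    have hmp := measurePreserving_update μ (κ := Fin n) i
    rw [ae_iff]
    simp only [ne_eq, not_not]
    rw [← hmp.measure_preimage hs.nullMeasurableSet,
      Measure.measure_prod_null (hmp.measurable hs)]
    refine Filter.Eventually.of_forall fun x => ?_
    refine measure_mono_null (fun y hy => ?_) (Measure.pi_eval_preimage_null (fun _ => μ) (hμ x)
      (i := j))
    simpa [Function.update_of_ne hij.symm, eq_comm] using hy
  have h2 : ∀ᵐ y : Fin n → E ∂(Measure.pi fun _ => μ), ∀ i j : Fin n, i ≠ j → y i ≠ y j := by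
    rw [ae_all_iff]; intro i
    rw [ae_all_iff]; intro j
    by_cases hij : i = j
    · exact Filter.Eventually.of_forall fun y hne => absurd hij hne
    · exact (h i j hij).mono fun y hy _ => hy
  exact h2.mono fun y hy i j hij => by_contra fun hne => hy i j hne hij

/-- The expected total is `n` times the expected contribution of one point. -/
lemma integral_vectorSum [MeasurableSpace E] [MeasurableEq E] (μ : Measure E)
    [IsProbabilityMeasure μ] (hμ : ∀ x, μ {x} = 0)
    (hψ : Measurable fun p : E × (Fin n → E) => ψ p.1 (Finset.univ.image p.2)) {B : ℝ}
    (hB : ∀ x 𝒳, |ψ x 𝒳| ≤ B) (i₀ : Fin n) :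
    ∫ y : Fin n → E, vectorSum ψ y ∂(Measure.pi fun _ => μ)
      = n * ∫ y : Fin n → E, ψ (y i₀) (Finset.univ.image y) ∂(Measure.pi fun _ => μ) := by
  have hm : ∀ i, Measurable fun y : Fin n → E => ψ (y i) (Finset.univ.image y) := fun i =>
    hψ.comp (f := fun y : Fin n → E => (y i, y)) (by fun_prop)
  have h1 : ∫ y : Fin n → E, vectorSum ψ y ∂(Measure.pi fun _ => μ)
      = ∫ y : Fin n → E, ∑ i, ψ (y i) (Finset.univ.image y) ∂(Measure.pi fun _ => μ) := by
    refine integral_congr_ae ((ae_injective μ hμ).mono fun y hy => ?_)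
    simp only [vectorSum, totalSum]
    exact Finset.sum_image fun i _ j _ h => hy h
  rw [h1, integral_finsetSum _ fun i _ => integrable_of_measurable_of_abs_le (hm i) fun y => hB _ _]
  -- Swapping two coordinates preserves both the law and the point set.
  have h2 : ∀ i, ∫ y : Fin n → E, ψ (y i) (Finset.univ.image y) ∂(Measure.pi fun _ => μ)
      = ∫ y : Fin n → E, ψ (y i₀) (Finset.univ.image y) ∂(Measure.pi fun _ => μ) := fun i => by
    rw [← integral_comp_injective μ (Equiv.swap i i₀).injective (hm i)]
    refine integral_congr_ae (Filter.Eventually.of_forall fun y => ?_)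
    have himg : Finset.univ.image (fun k => y (Equiv.swap i i₀ k)) = Finset.univ.image y := by
      ext x
      simp only [Finset.mem_image, Finset.mem_univ, true_and]
      exact ⟨fun ⟨k, hk⟩ => ⟨_, hk⟩, fun ⟨k, hk⟩ => ⟨Equiv.swap i i₀ k, by simpa using hk⟩⟩
    simp only [himg, Equiv.swap_apply_left]
  simp [h2]

end Sums

/-! ### Assembly on the torus. -/

lemma abs_le_toReal_functionalNorm {d n : ℕ} {ψ : Torus d n → Finset (Torus d n) → ℝ}
    (h : functionalNorm ψ ≠ ∞) (x : Torus d n) (𝒳 : Finset (Torus d n)) :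
    |ψ x 𝒳| ≤ (functionalNorm ψ).toReal := by
  have h1 : ‖ψ x 𝒳‖ₑ ≤ functionalNorm ψ :=
    le_iSup₂ (f := fun x (𝒳 : Finset (Torus d n)) => ‖ψ x 𝒳‖ₑ) x 𝒳
  have h2 := ENNReal.toReal_mono h h1
  simpa using h2

/-- A lower bound for the `d`-th power of an influence radius whose ball has volume at least one. -/
noncomputable def radiusConst (d : ℕ) : ℝ :=
  (Real.pi ^ (-(1 / 2) : ℝ) * Real.Gamma (1 + (d : ℝ) / 2) ^ ((1 : ℝ) / d)) ^ d

lemma radiusConst_base_pos (d : ℕ) :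
    0 < Real.pi ^ (-(1 / 2) : ℝ) * Real.Gamma (1 + (d : ℝ) / 2) ^ ((1 : ℝ) / d) :=
  mul_pos (Real.rpow_pos_of_pos Real.pi_pos _)
    (Real.rpow_pos_of_pos (Real.Gamma_pos_of_pos (by positivity)) _)

lemma radiusConst_pos (d : ℕ) : 0 < radiusConst d := pow_pos (radiusConst_base_pos d) d

/-- The normal approximation theorem on the space of point vectors. -/
lemma wassersteinDist_vectorSum_div_le {d n : ℕ} [NeZero n] [DecidableEq (Torus d n)] (hd : 1 ≤ d)
    {ψ : Torus d n → Finset (Torus d n) → ℝ} {ρ B σ : ℝ} (hloc : IsLocalFunctional ψ ρ)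
    (hρ0 : 0 ≤ ρ) (hρ : radiusConst d ≤ ρ ^ d) (hB : ∀ x 𝒳, |ψ x 𝒳| ≤ B)
    (hm : Measurable (vectorSum ψ : (Fin n → Torus d n) → ℝ)) (hσ : 0 < σ)
    (h0 : ∫ y : Fin n → Torus d n, vectorSum ψ y ∂(Measure.pi fun _ => torusUniform d n) = 0)
    (h2 : ∫ y : Fin n → Torus d n, vectorSum ψ y ^ 2 ∂(Measure.pi fun _ => torusUniform d n)
      = σ ^ 2) :
    wassersteinDist ((Measure.pi fun _ : Fin n => torusUniform d n).map
        fun y => vectorSum ψ y / σ) (gaussianReal 0 1)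
      ≤ ENNReal.ofReal (localConst * (4 ^ (d + 1) + 1 / radiusConst d) ^ 6
          * B ^ 3 * (ρ ^ (6 * d) * n / σ ^ 3)) := by
  have := isProbabilityMeasure_torusUniform (n := n) hd
  have hn : (0 : ℝ) < n := Nat.cast_pos.mpr (Nat.pos_of_ne_zero (NeZero.ne n))
  have hc := radiusConst_pos d
  have hV : (vectorSum fun x 𝒳 => ψ x 𝒳 / σ)
      = fun y : Fin n → Torus d n => vectorSum ψ y / σ := by
    funext y
    simp only [vectorSum, totalSum, Finset.sum_div]
  -- The functional is rescaled to `ψ / σ`. In `v`, the summand `4^(d+1) ρ^d` is exactly `4 n p` for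
  -- the cube of side `4ρ`, and `ρ^d / radiusConst d` ensures `v ≥ 1`.
  have hmain := IsLocalFunctional.wassersteinDist_le (torusUniform d n) (n := n)
    (ψ := fun x 𝒳 => ψ x 𝒳 / σ) (ρ := ρ) (B := B / σ) (p := (2 * (2 * ρ)) ^ d / n)
    (v := (4 ^ (d + 1) + 1 / radiusConst d) * ρ ^ d)
    (fun x 𝒳 𝒴 h => by simp only [hloc x 𝒳 𝒴 h]) hρ0
    (fun x 𝒳 => by
      rw [abs_div, abs_of_pos hσ]
      exact div_le_div_of_nonneg_right (hB x 𝒳) hσ.le)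
    (by rw [hV]; exact hm.div_const σ)
    (fun x => torusUniform_closedBall_le hd (by positivity) x) ?_ ?_ ?_ ?_
  · rw [hV] at hmain
    refine hmain.trans_eq ?_
    congr 1
    field_simp
    ring
  · have h1 : 1 ≤ 1 / radiusConst d * ρ ^ d := by
      rw [one_div_mul_eq_div, one_le_div hc]
      exact hρ
    have h3 : (0 : ℝ) ≤ 4 ^ (d + 1) * ρ ^ d := by positivity
    linarith
  · have h1 : 0 ≤ 1 / radiusConst d * ρ ^ d := by positivity
    have h3 : 4 * (n : ℝ) * ((2 * (2 * ρ)) ^ d / n) = 4 ^ (d + 1) * ρ ^ d := by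
      rw [← mul_assoc 2 2 ρ, mul_pow]
      field_simp
      norm_num
      ring
    linarith
  · rw [hV, integral_div, h0, zero_div]
  · rw [hV]
    simp only [div_pow]
    rw [integral_div, h2, div_self (by positivity)]

theorem mainTheorem8 (d : ℕ) (hd : 1 ≤ d) :
    ∃ C : ℝ, 0 < C ∧
      ∀ (n : ℕ) [NeZero n] (ψ : Torus d n → Finset (Torus d n) → ℝ) (ρ : ℝ),
        MeasurableFunctional ψ →
        TranslationInvariant ψ →
        HasInfluenceRadius ψ ρ →
        Real.pi ^ (-(1 / 2) : ℝ) * Real.Gamma (1 + (d : ℝ) / 2) ^ ((1 : ℝ) / d) ≤ ρ →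
        ρ < (1 / 2) * (n : ℝ) ^ ((1 : ℝ) / d) →
        ∀ (Ω : Type*) [MeasurableSpace Ω] (P : Measure Ω) [IsProbabilityMeasure P]
          (X : Fin n → Ω → Torus d n),
          (∀ i, Measurable (X i)) →
          iIndepFun X P →
          (∀ i, pdf.IsUniform (X i) Set.univ P volume) →
          ∫ ω, ψ (X 0 ω) (pointSet X ω) ∂P = 0 →
          0 < neighbourhoodSigma P ψ X →
          wassersteinDist (P.map (neighbourhoodStatistic P ψ X)) (gaussianReal 0 1) ≤
            ENNReal.ofReal C * functionalNorm ψ ^ 3 *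
              ENNReal.ofReal (ρ ^ (6 * d) * n / neighbourhoodSigma P ψ X ^ 3) := by
  classical
  have hc := radiusConst_pos d
  have hC : 0 < localConst * (4 ^ (d + 1) + 1 / radiusConst d) ^ 6 :=
    mul_pos localConst_pos (by positivity)
  refine ⟨_, hC, ?_⟩
  intro n _ ψ ρ hψm _ hinf hρ _ Ω _ P _ X hX hind hunif hmean hσ
  have hn : (0 : ℝ) < n := Nat.cast_pos.mpr (Nat.pos_of_ne_zero (NeZero.ne n))
  have hρ0 : 0 < ρ := (radiusConst_base_pos d).trans_le hρ
  set σ := neighbourhoodSigma P ψ X with hσdef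
  have hpos : 0 < ρ ^ (6 * d) * n / σ ^ 3 := by positivity
  -- For unbounded `ψ` the right side is `∞`, since its other two factors are positive.
  rcases eq_or_ne (functionalNorm ψ) ∞ with htop | hfin
  · rw [htop, ENNReal.top_pow (by norm_num), ENNReal.mul_top (by simpa using hC),
      ENNReal.top_mul (by simpa using hpos)]
    exact le_top
  have hB := abs_le_toReal_functionalNorm hfin
  set B := (functionalNorm ψ).toReal
  have hprob := isProbabilityMeasure_torusUniform (n := n) hd
  have hψn : Measurable fun p : Torus d n × (Fin n → Torus d n) =>
      ψ p.1 (Finset.univ.image p.2) := by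
    convert hψm n
  have hVm : Measurable (vectorSum ψ : (Fin n → Torus d n) → ℝ) := measurable_vectorSum hψn
  have hXm : Measurable fun ω i => X i ω := measurable_pi_lambda _ hX
  -- From here every integral over `Ω` is transferred to the product of uniform laws.
  have hlaw : P.map (fun ω i => X i ω) = Measure.pi fun _ => torusUniform d n := by
    rw [(iIndepFun_iff_map_fun_eq_pi_map fun i => (hX i).aemeasurable).mp hind]
    congr 1
    funext i
    exact hunif i
  have hset : ∀ ω, pointSet X ω = Finset.univ.image fun i => X i ω := fun ω => by
    unfold pointSet
    congr!
  have hsum : neighbourhoodSum ψ X = fun ω => vectorSum ψ fun i => X i ω := by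
    funext ω
    simp only [neighbourhoodSum, vectorSum, totalSum, hset]
  have h0m : Measurable fun y : Fin n → Torus d n => ψ (y 0) (Finset.univ.image y) :=
    hψn.comp (f := fun y : Fin n → Torus d n => (y 0, y)) (by fun_prop)
  have h0 : ∫ y : Fin n → Torus d n, vectorSum ψ y ∂(Measure.pi fun _ => torusUniform d n) = 0 := by
    rw [integral_vectorSum (torusUniform d n) (torusUniform_singleton hd) hψn hB 0, ← hlaw,
      integral_map hXm.aemeasurable h0m.aestronglyMeasurable]
    simp only [hset] at hmean
    rw [hmean, mul_zero]
  have h2 : ∫ y : Fin n → Torus d n, vectorSum ψ y ^ 2 ∂(Measure.pi fun _ => torusUniform d n)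
      = σ ^ 2 := by
    have hvar : variance (neighbourhoodSum ψ X) P
        = ∫ y : Fin n → Torus d n, vectorSum ψ y ^ 2 ∂(Measure.pi fun _ => torusUniform d n) := by
      have hE : ∫ ω, vectorSum ψ (fun i => X i ω) ∂P = 0 := by
        rw [← h0, ← hlaw, integral_map hXm.aemeasurable hVm.aestronglyMeasurable]
      rw [hsum, variance_eq_integral (by exact (hVm.comp hXm).aemeasurable), hE, ← hlaw,
        integral_map hXm.aemeasurable (hVm.pow_const 2).aestronglyMeasurable]
      simp only [sub_zero]
    rw [hσdef, neighbourhoodSigma, Real.sq_sqrt (variance_nonneg _ _), hvar]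
  have hstat : P.map (neighbourhoodStatistic P ψ X)
      = (Measure.pi fun _ : Fin n => torusUniform d n).map fun y => vectorSum ψ y / σ := by
    rw [← hlaw, Measure.map_map (hVm.div_const σ) hXm]
    congr 1
  rw [hstat]
  refine (wassersteinDist_vectorSum_div_le hd hinf.isLocalFunctional hρ0.le
    (pow_le_pow_left₀ (radiusConst_base_pos d).le hρ d) hB hVm hσ h0 h2).trans_eq ?_
  rw [ENNReal.ofReal_mul (by positivity), ENNReal.ofReal_mul hC.le, ENNReal.ofReal_pow
    ENNReal.toReal_nonneg, ENNReal.ofReal_toReal hfin]
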